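/- Let $d\ge 1$ and let $\mathbb H^d=\mathbb R^d\times\mathbb R^d\times\mathbb R$ be the Heisenberg group, with points $(z,s)$, $z=(x,y)$, group law $(z,s)\boxplus(z',s')=(z+z',s+s'+\frac12(y\cdot x'-x\cdot y'))$ and Lebesgue measure. For $\lambda\ne0$ let $U^\lambda_{(z,s)}\alpha(q)=e^{i\lambda(s+x\cdot q+x\cdot y/2)}\alpha(q+y)$ be the Schrödinger representation on $L^2(\mathbb R^d)$, $\mathcal Fu(\lambda)=\int_{\mathbb H^d}u(v)\,U^\lambda_v\,dv$ the Fourier transform, and $\eta_k^\lambda=|\lambda|^{d/4}\eta_k(|\lambda|^{1/2}\,\cdot)$, $k\in\mathbb N^d$, the rescaled $L^2$-normalised Hermite functions, with projections $P_k^\lambda=\eta_k^\lambda\langle\eta_k^\lambda,\cdot\rangle$. For a continuous function $\varphi:[0,\infty)\to\mathbb C$, we write $\varphi(-\Delta)\delta\in L^2(\mathbb H^d)$ if there is an $f\in L^2(\mathbb H^d)$ with $\mathcal Ff(\lambda)=\sum_{k\in\mathbb N^d}\varphi(|\lambda|(d+2|k|))P_k^\lambda$ for almost every $\lambda$; this $f$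 is then denoted $\varphi(-\Delta)\delta$ (it is the right convolution kernel of the sub-Laplacian multiplier $\varphi(-\Delta)$). For $n\in\mathbb N$ and $\lambda\neq0$ put $$\ell_n^\lambda(z,s)=\binom{d-1+n}{n}^{-1}e^{-i\lambda s-|\lambda||z|^2/4}\,L_n^{d-1}(|\lambda||z|^2/2),$$ with $L_n^{d-1}$ the Laguerre polynomial of degree $n$ and type $d-1$, and let $\mathcal Gu(n,\lambda)=\langle\ell_n^\lambda,u\rangle=\int_{\mathbb H^d}\overline{\ell_n^\lambda(v)}\,u(v)\,dv$ be the biradial (Laguerre) transform, understood in the sense of distributions in $\lambda\in\mathbb R\setminus\{0\}$ when the integral does not converge: for every $\psi\in C_c^\infty(\mathbb R\setminus\{0\})$, $\int_{\mathbb R}\psi(\lambda)\,\mathcal Gu(n,\lambda)\,d\lambda=\int_{\mathbb H^d}u(v)\int_{\mathbb R}\psi(\lambda)\,\overline{\ell_n^\lambda(v)}\,d\lambda\,dv$. **Lemma 3.2.** For every $d\ge1$ and $m\in\mathbb N$ there is a constant $C_m$ (depending only on $d$ and $m$) such that the following holds. Let $\varphi\in C^{2m}([0,\infty))$ be complex-valued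 (with one-sided derivatives at $0$) and such that $\varphi(-\Delta)\delta\in L^2(\mathbb H^d)$. Then $\mathcal G[(is-\frac14|z|^2)^m\varphi(-\Delta)\delta](n,\cdot)$ is a continuous function on $\mathbb R\setminus\{0\}$ for every $n\in\mathbb N$, and for every extension of $\varphi$ to a function in $C^{2m}(\mathbb R)$, again denoted by $\varphi$, and for all $n\in\mathbb N$ and $\lambda\in\mathbb R\setminus\{0\}$, $$\Big|\mathcal G\big[(is-\tfrac14|z|^2)^m\varphi(-\Delta)\delta\big](n,\lambda)\Big|\le C_m\sum_{\ell=0}^m\ \sup_{\omega\in[-2m,2m]}\Big|(n\lambda)^\ell\,\partial^{m+\ell}\varphi\big(|\lambda|(d+2n+\omega)\big)\Big|.$$ -/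

import Mathlib

open scoped ContDiff

noncomputable section

namespace Heisenberg

/-- The Heisenberg group as a set: points `v = (x, y, s)` with `x, y ∈ ℝ^d`, `s ∈ ℝ`, and `z = (x, y)`.
The measure `volume` is Lebesgue measure on `ℝ^(2d+1)`, which is the Haar measure. The group law
`(z, s) ⊞ (z', s') = (z + z', s + s' + (y ⬝ x' - x ⬝ y') / 2)` enters only through the
Schrödinger representation `schrodinger` below, which is a homomorphism for it. -/
abbrev Pt (d : ℕ) : Type := (Fin d → ℝ) × (Fin d → ℝ) × ℝ

/-- The square `|z|²` of the Euclidean norm of `z = (x, y)`. -/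
def zNormSq {d : ℕ} (v : Pt d) : ℝ := ∑ i, (v.1 i ^ 2 + v.2.1 i ^ 2)

/-- The polynomial `i s - |z|² / 4`. -/
def posPoly {d : ℕ} (v : Pt d) : ℂ := Complex.I * (v.2.2 : ℂ) - ((zNormSq v / 4 : ℝ) : ℂ)

/-- The Schrödinger representation
`(U_v^λ α)(q) = exp(i λ (s + x ⬝ q + x ⬝ y / 2)) α(q + y)`. -/
def schrodinger {d : ℕ} (lam : ℝ) (v : Pt d) (α : (Fin d → ℝ) → ℂ) (q : Fin d → ℝ) : ℂ :=
  Complex.exp (Complex.I * ((lam * (v.2.2 + ∑ i, v.1 i * q i + (∑ i, v.1 i * v.2.1 i) / 2) : ℝ) : ℂ))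
    * α (q + v.2.1)

/-- The `L²`-normalised Hermite functions of one variable. Mathlib's `Polynomial.hermite` is the
probabilists' polynomial `He_k`, hence the argument `√2 t`
(the physicists' polynomial is `H_k(t) = 2^(k/2) He_k(√2 t)`). -/
def hermiteFun (k : ℕ) (t : ℝ) : ℝ :=
  (Real.sqrt ((k.factorial : ℝ) * Real.sqrt Real.pi))⁻¹
    * Polynomial.aeval (Real.sqrt 2 * t) (Polynomial.hermite k) * Real.exp (-t ^ 2 / 2)

/-- The stretched Hermite function `η_k^λ(q) = |λ|^(d/4) ∏ i, η_{k_i}(|λ|^(1/2) q_i)`, `k ∈ ℕ^d`,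
an eigenfunction of `H_λ = λ² |q|² - Δ` with eigenvalue `|λ| (d + 2 |k|)`. -/
def hermiteScaled {d : ℕ} (k : Fin d → ℕ) (lam : ℝ) (q : Fin d → ℝ) : ℂ :=
  ((|lam| ^ ((d : ℝ) / 4) * ∏ i, hermiteFun (k i) (Real.sqrt |lam| * q i) : ℝ) : ℂ)

/-- The matrix coefficient `⟨η_j^λ, U_v^λ η_k^λ⟩` in `L²(ℝ^d)`
(the inner product is conjugate-linear in its first argument). -/
def matrixCoeff {d : ℕ} (j k : Fin d → ℕ) (lam : ℝ) (v : Pt d) : ℂ :=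
  ∫ q : Fin d → ℝ,
    starRingEnd ℂ (hermiteScaled j lam q) * schrodinger lam v (hermiteScaled k lam) q

/-- Test functions in the frequency variable: smooth and compactly supported in `ℝ ∖ {0}`. -/
structure IsFreqTest (ψ : ℝ → ℂ) : Prop where
  smooth : ContDiff ℝ ∞ ψ
  compact : HasCompactSupport ψ
  away : (0 : ℝ) ∉ tsupport ψ

/-- The group Fourier transform `ℱu(λ) = ∫ u(v) U_v^λ dv` is, for (almost) all `λ ≠ 0`, the operator
with matrix entries `⟨η_j^λ, ℱu(λ) η_k^λ⟩ = A λ j k`. The integral over `v` need not converge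
for a fixed `λ` (`u` is only square integrable), so, as for tempered distributions, it is tested
against functions of `λ`: `(u, ∫ ψ(λ) ⟨η_j^λ, U_v^λ η_k^λ⟩ dλ) = ∫ ψ(λ) A λ j k dλ`. -/
def HasFourierMatrix {d : ℕ} (u : Pt d → ℂ)
    (A : ℝ → (Fin d → ℕ) → (Fin d → ℕ) → ℂ) : Prop :=
  ∀ j k : Fin d → ℕ, ∀ ψ : ℝ → ℂ, IsFreqTest ψ →
    ∫ v : Pt d, u v * ∫ lam : ℝ, ψ lam * matrixCoeff j k lam v = ∫ lam : ℝ, ψ lam * A lam j k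

/-- The matrix of `φ(H_λ) = ∑ k, φ(|λ| (d + 2|k|)) P_k^λ` in the basis `η_k^λ`. -/
def multiplierMatrix {d : ℕ} (φ : ℝ → ℂ) (lam : ℝ) (j k : Fin d → ℕ) : ℂ :=
  if j = k then φ (|lam| * ((d : ℝ) + 2 * ((∑ i, k i : ℕ) : ℝ))) else 0

/-- `φ(-Δ)δ ∈ L²`, and `f` represents it: `f` is the square integrable function with
`ℱf(λ) = ∑ k, φ(|λ| (d + 2|k|)) P_k^λ`, that is, the right convolution kernel of the operator
`φ(-Δ) g = ℱ⁻¹[ℱg ∑ k, φ(|λ| (d + 2|k|)) P_k^λ]`.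
By Plancherel's theorem `f` is unique up to a null set. -/
structure IsL2Kernel {d : ℕ} (φ : ℝ → ℂ) (f : Pt d → ℂ) : Prop where
  memLp : MeasureTheory.MemLp f 2 MeasureTheory.volume
  fourier : HasFourierMatrix f (multiplierMatrix φ)

/-- The generalised Laguerre polynomial `L_n^a(t) = ∑_{i ≤ n} (-1)^i (n+a choose n-i) t^i / i!`. -/
def laguerre (a n : ℕ) (t : ℝ) : ℝ :=
  ∑ i ∈ Finset.range (n + 1),
    (-1) ^ i * ((n + a).choose (n - i) : ℝ) * t ^ i / (i.factorial : ℝ)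

/-- `ℓ_n^λ(z, s) = (d-1+n choose n)⁻¹ exp(-i λ s - |λ| |z|² / 4) L_n^{d-1}(|λ| |z|² / 2)`, `d ≥ 1`. -/
def ell {d : ℕ} (n : ℕ) (lam : ℝ) (v : Pt d) : ℂ :=
  (((d - 1 + n).choose n : ℝ)⁻¹ : ℝ)
    * Complex.exp (-Complex.I * ((lam * v.2.2 : ℝ) : ℂ) - ((|lam| * zNormSq v / 4 : ℝ) : ℂ))
    * (laguerre (d - 1) n (|lam| * zNormSq v / 2) : ℂ)

/-- `Ω` is the biradial transform `𝒢u(n, λ) = ⟨ℓ_n^λ, u⟩`, `n ∈ ℕ`, `λ ≠ 0`, of `u`. The pairing is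
understood in the sense of distributions in `λ ∈ ℝ ∖ {0}`, because `u` need be neither integrable
nor square integrable. Continuity in `λ ≠ 0` makes the values `Ω n λ`, `λ ≠ 0`, unique. -/
structure IsBiradialTransform {d : ℕ} (u : Pt d → ℂ) (Ω : ℕ → ℝ → ℂ) : Prop where
  cont : ∀ n, ContinuousOn (Ω n) {0}ᶜ
  integrable : ∀ n : ℕ, ∀ ψ : ℝ → ℂ, IsFreqTest ψ →
    MeasureTheory.Integrable
      (fun v : Pt d => u v * ∫ lam : ℝ, ψ lam * starRingEnd ℂ (ell n lam v))
      MeasureTheory.volume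
  pairing : ∀ n : ℕ, ∀ ψ : ℝ → ℂ, IsFreqTest ψ →
    ∫ v : Pt d, u v * ∫ lam : ℝ, ψ lam * starRingEnd ℂ (ell n lam v) = ∫ lam : ℝ, ψ lam * Ω n lam

end Heisenberg

end

noncomputable section

namespace Heisenberg

/-! ### Laguerre polynomials -/

/-! The transform turns multiplication by `p = i s - |z|² / 4` into a first-order operator in `(n,
λ)`, and the estimate follows from an exact spline formula for its `m`-th power.

On the frequency side, a Gaussian integral of shifted Hermite polynomials shows that a diagonal
matrix coefficient is `exp(iλs - |λ||z|²/4)` times a product of Laguerre polynomials of type 0.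
Multiplying generating functions sums these over `|k| = n` to a multiple of the conjugate of `ℓ_n^λ`
(`sum_matrixCoeff_self`), so the kernel itself has transform `φ(|λ|(d + 2n))`
(`IsL2Kernel.pairing_ell`). The derivative of that conjugate in `λ` is `p` times it plus a
difference in `n`, backward with weight `n/λ` for `λ > 0` and forward with weight `(n+d)/λ` for `λ <
0` (`hasDerivAt_conj_ell`). By duality each factor `p` acts on the transform as `∂_λ` minus these
differences (`IsL2Kernel.pairing_posPoly_pow`). The pairings converge although `p^m f` need not be
in `L²`, because averaging `ℓ_n^λ` over `λ` produces rapid decay in `v`.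

With `a = n` for `λ > 0` and `a = -n - d` for `λ < 0`, both cases become `∂_λ - (a/λ)∇_a` acting on
`Φ(λ(d + 2a))`. First-order terms in `a` cancel. What is left is one derivative of `Φ` with a
bounded weight, or two derivatives with an extra factor `aλ` and a second-order Taylor remainder.
Iterating gives a sum over `l ≤ m` of `a(a-1)⋯(a-l+1) λ^l` times a spline average of `Φ^(m+l)`
(`hasDerivAt_splineSum`, `biradial_eq_splineSum`). For `n ≥ 1` the falling factorial is `O(n^l)` and
the bound is immediate. For `n = 0` only the term with `l = 0` survives on the right, so the surplus
derivatives are integrated by parts onto the spline (`norm_splineFunctional_deriv_le`). -/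

theorem laguerre_eq_sum_range (a n N : ℕ) (hN : n + 1 ≤ N) (t : ℝ) :
    laguerre a n t =
      ∑ i ∈ Finset.range N, (-1) ^ i * ((n + a).choose (a + i) : ℝ) * t ^ i / (i.factorial : ℝ) := by
  rw [laguerre, ← Finset.sum_subset (Finset.range_subset_range.2 hN)]
  · refine Finset.sum_congr rfl fun i hi => ?_
    have hi' : i ≤ n := Nat.lt_succ_iff.1 (Finset.mem_range.1 hi)
    rw [← Nat.choose_symm (n := n + a) (k := a + i) (by omega)]
    congr 5
    omega
  · intro i _ hi
    have : n < i := by simpa using hi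
    -- The padded coefficients vanish, so Laguerre polynomials of different degrees can share one
    -- summation range.
    rw [Nat.choose_eq_zero_of_lt (by omega)]
    simp

theorem laguerre_zero_left (a : ℕ) (t : ℝ) : laguerre a 0 t = 1 := by
  simp [laguerre]

theorem laguerre_at_zero (a n : ℕ) : laguerre a n 0 = ((n + a).choose n : ℝ) := by
  rw [laguerre, Finset.sum_eq_single 0]
  · simp
  · intro i _ hi
    simp [hi]
  · simp

theorem laguerre_pascal (a n : ℕ) (t : ℝ) :
    laguerre (a + 1) (n + 1) t = laguerre (a + 1) n t + laguerre a (n + 1) t := by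
  rw [laguerre_eq_sum_range _ _ (n + 2) le_rfl, laguerre_eq_sum_range (a + 1) n (n + 2) (by omega),
    laguerre_eq_sum_range a _ (n + 2) le_rfl, ← Finset.sum_add_distrib]
  refine Finset.sum_congr rfl fun i _ => ?_
  have : (n + 1 + (a + 1)).choose (a + 1 + i)
      = (n + (a + 1)).choose (a + 1 + i) + (n + 1 + a).choose (a + i) := by
    rw [show n + 1 + (a + 1) = (n + 1 + a) + 1 by ring, show a + 1 + i = (a + i) + 1 by ring,
      Nat.choose_succ_succ, show n + (a + 1) = n + 1 + a by ring, add_comm]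
  rw [this]
  push_cast
  ring

theorem hasDerivAt_laguerre_succ (a n : ℕ) (t : ℝ) :
    HasDerivAt (laguerre a (n + 1)) (-laguerre (a + 1) n t) t := by
  have h : laguerre a (n + 1) = fun t => ∑ i ∈ Finset.range (n + 2),
      ((-1) ^ i * ((n + 1 + a).choose (a + i) : ℝ) / (i.factorial : ℝ)) * t ^ i := by
    funext t
    rw [laguerre_eq_sum_range _ _ (n + 2) le_rfl]
    exact Finset.sum_congr rfl fun i _ => by ring
  rw [h]
  have h2 := HasDerivAt.fun_sum (u := Finset.range (n + 2)) (x := t)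
    (A := fun i t => ((-1) ^ i * ((n + 1 + a).choose (a + i) : ℝ) / (i.factorial : ℝ)) * t ^ i)
    fun i _ => (hasDerivAt_pow i t).const_mul _
  have h3 : -laguerre (a + 1) n t = ∑ i ∈ Finset.range (n + 2),
      ((-1) ^ i * ((n + 1 + a).choose (a + i) : ℝ) / (i.factorial : ℝ)) * (i * t ^ (i - 1)) := ?_
  · rw [h3]
    exact h2
  clear h2
  rw [Finset.sum_range_succ', laguerre_eq_sum_range _ _ (n + 1) le_rfl, ← Finset.sum_neg_distrib]
  simp only [Nat.cast_zero, zero_mul, mul_zero, add_zero]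
  refine Finset.sum_congr rfl fun i _ => ?_
  rw [show n + (a + 1) = n + 1 + a by ring, show a + 1 + i = a + (i + 1) by ring,
    Nat.factorial_succ]
  have : (i.factorial : ℝ) ≠ 0 := by positivity
  push_cast
  field_simp
  ring

/-- Compare coefficients of each power of `t`. This is what converts the derivative of a Laguerre
factor into a difference in `n`. -/
theorem mul_laguerre_succ_left (a n : ℕ) (t : ℝ) :
    t * laguerre (a + 1) n t
      = ((n : ℝ) + 1 + a) * laguerre a n t - ((n : ℝ) + 1) * laguerre a (n + 1) t := by
  rw [laguerre_eq_sum_range (a + 1) n (n + 1) le_rfl,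
    laguerre_eq_sum_range a n (n + 2) (by omega), laguerre_eq_sum_range a (n + 1) (n + 2) le_rfl,
    Finset.sum_range_succ' _ (n + 1), Finset.sum_range_succ' _ (n + 1), mul_add, mul_add,
    Finset.mul_sum, Finset.mul_sum, Finset.mul_sum]
  have h0 : ((n : ℝ) + 1 + a) * ((n + a).choose a : ℝ) = (n + 1) * ((n + 1 + a).choose a : ℝ) := by
    have := Nat.choose_mul_succ_eq (n + a) a
    have h2 : ((n + a).choose a : ℝ) * (n + a + 1) = ((n + a + 1).choose a : ℝ) * (n + 1) := by
      have h3 : n + a + 1 - a = n + 1 := by omega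
      rw [h3] at this
      exact_mod_cast this
    rw [show n + 1 + a = n + a + 1 by ring]
    linarith
  have hs : ∀ i ∈ Finset.range (n + 1),
      t * ((-1) ^ i * ((n + (a + 1)).choose (a + 1 + i) : ℝ) * t ^ i / (i.factorial : ℝ))
      = ((n : ℝ) + 1 + a) * ((-1) ^ (i + 1) * ((n + a).choose (a + (i + 1)) : ℝ) * t ^ (i + 1)
          / ((i + 1).factorial : ℝ))
        - ((n : ℝ) + 1) * ((-1) ^ (i + 1) * ((n + 1 + a).choose (a + (i + 1)) : ℝ) * t ^ (i + 1)
          / ((i + 1).factorial : ℝ)) := by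
    intro i hi
    have hi' : i ≤ n := Nat.lt_succ_iff.1 (Finset.mem_range.1 hi)
    have h1 : ((n : ℝ) + 1 + a) * ((n + a).choose (a + (i + 1)) : ℝ)
        = (n - i) * ((n + 1 + a).choose (a + (i + 1)) : ℝ) := by
      have := Nat.choose_mul_succ_eq (n + a) (a + (i + 1))
      have h3 : n + a + 1 - (a + (i + 1)) = n - i := by omega
      rw [h3] at this
      have h2 : ((n + a).choose (a + (i + 1)) : ℝ) * (n + a + 1)
          = ((n + a + 1).choose (a + (i + 1)) : ℝ) * ((n - i : ℕ) : ℝ) := by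
        exact_mod_cast this
      rw [Nat.cast_sub hi'] at h2
      rw [show n + 1 + a = n + a + 1 by ring]
      linarith
    rw [show n + (a + 1) = n + 1 + a by ring, show a + 1 + i = a + (i + 1) by ring,
      Nat.factorial_succ]
    have : (i.factorial : ℝ) ≠ 0 := by positivity
    push_cast
    field_simp
    linear_combination (-1) ^ i * t * t ^ i * h1
  rw [Finset.sum_congr rfl hs, Finset.sum_sub_distrib]
  simp only [pow_zero, one_mul, mul_one, add_zero, Nat.factorial_zero, Nat.cast_one, div_one]
  linear_combination -h0

/-- The generating function `∑ n, L_n^a(t) X^n` of the Laguerre polynomials. -/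
def laguerreSeries (a : ℕ) (t : ℝ) : PowerSeries ℝ := PowerSeries.mk fun n => laguerre a n t

/-- The generating function is `∑ i, (-t)^i / i! · X^i / (1-X)^(a+i+1)`; these are its building
blocks. -/
theorem coeff_X_pow_mul_invOneSubPow (a i n : ℕ) :
    PowerSeries.coeff n (PowerSeries.X ^ i * (PowerSeries.invOneSubPow ℝ (a + i + 1)).val)
      = ((n + a).choose (a + i) : ℝ) := by
  rw [PowerSeries.coeff_X_pow_mul', PowerSeries.invOneSubPow_val_succ_eq_mk_add_choose]
  split_ifs with h
  · rw [PowerSeries.coeff_mk]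
    congr 2
    omega
  · rw [Nat.choose_eq_zero_of_lt (by omega)]
    simp

/-- Formally the series is `(1-X)^(-a-1) exp(-tX/(1-X))`: exponentials multiply and the exponents
`a+1`, `b+1` add. The exponential is expanded and truncated, since only finitely many terms reach
the coefficient of `X^n`. -/
theorem laguerreSeries_mul (a b : ℕ) (x y : ℝ) :
    laguerreSeries a x * laguerreSeries b y = laguerreSeries (a + b + 1) (x + y) := by
  ext n
  set c : ℝ → ℕ → ℝ := fun x i => (-1) ^ i * x ^ i / (i.factorial : ℝ)
  set P : ℕ → ℕ → PowerSeries ℝ := fun a i =>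
    PowerSeries.X ^ i * (PowerSeries.invOneSubPow ℝ (a + i + 1)).val
  have hL : ∀ (a n N : ℕ) (x : ℝ), n + 1 ≤ N → laguerre a n x
      = PowerSeries.coeff n (∑ i ∈ Finset.range N, c x i • P a i) := by
    intro a n N x hN
    rw [laguerre_eq_sum_range _ _ N hN, map_sum]
    refine Finset.sum_congr rfl fun i _ => ?_
    rw [map_smul, coeff_X_pow_mul_invOneSubPow, smul_eq_mul]
    ring
  have hP : ∀ i j, P a i * P b j = P (a + b + 1) (i + j) := by
    intro i j
    simp only [P]
    have : (PowerSeries.invOneSubPow ℝ (a + b + 1 + (i + j) + 1)).val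
        = (PowerSeries.invOneSubPow ℝ (a + i + 1)).val
          * (PowerSeries.invOneSubPow ℝ (b + j + 1)).val := by
      rw [← Units.val_mul, ← PowerSeries.invOneSubPow_add]
      congr 2
      ring
    rw [this]
    ring
  have hP0 : ∀ r, n < r → PowerSeries.coeff n (P (a + b + 1) r) = 0 := by
    intro r hr
    simp only [P]
    rw [PowerSeries.coeff_X_pow_mul', if_neg (by omega)]
  -- The functional equation of the exponential, degree by degree: the binomial theorem.
  have hcc : ∀ r, ∑ k ∈ Finset.range (r + 1), c x k * c y (r - k) = c (x + y) r := by
    intro r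
    simp only [c]
    rw [add_pow, Finset.mul_sum, Finset.sum_div]
    refine Finset.sum_congr rfl fun k hk => ?_
    have hk' : k ≤ r := Nat.lt_succ_iff.1 (Finset.mem_range.1 hk)
    rw [Nat.cast_choose ℝ hk', show (-1 : ℝ) ^ r = (-1) ^ k * (-1) ^ (r - k) by rw [← pow_add, Nat.add_sub_cancel' hk']]
    have h1 : (k.factorial : ℝ) ≠ 0 := by positivity
    have h2 : ((r - k).factorial : ℝ) ≠ 0 := by positivity
    have h3 : (r.factorial : ℝ) ≠ 0 := by positivity
    field_simp
  rw [PowerSeries.coeff_mul]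
  have h1 : ∀ p ∈ Finset.HasAntidiagonal.antidiagonal n,
      PowerSeries.coeff p.1 (laguerreSeries a x) * PowerSeries.coeff p.2 (laguerreSeries b y)
      = PowerSeries.coeff p.1 (∑ i ∈ Finset.range (n + 1), c x i • P a i)
        * PowerSeries.coeff p.2 (∑ i ∈ Finset.range (n + 1), c y i • P b i) := by
    intro p hp
    have hp' := Finset.HasAntidiagonal.mem_antidiagonal.1 hp
    rw [laguerreSeries, laguerreSeries, PowerSeries.coeff_mk, PowerSeries.coeff_mk,
      hL a p.1 (n + 1) x (by omega), hL b p.2 (n + 1) y (by omega)]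
  rw [Finset.sum_congr rfl h1, ← PowerSeries.coeff_mul, laguerreSeries, PowerSeries.coeff_mk,
    hL _ n (n + 1) _ le_rfl, Finset.sum_mul_sum, map_sum, map_sum]
  have h2 : ∀ i ∈ Finset.range (n + 1),
      PowerSeries.coeff n (∑ j ∈ Finset.range (n + 1), (c x i • P a i) * (c y j • P b j))
      = ∑ j ∈ Finset.range (n + 1 - i),
        (c x i * c y j) * PowerSeries.coeff n (P (a + b + 1) (i + j)) := by
    intro i hi
    rw [map_sum]
    symm
    rw [← Finset.sum_subset (Finset.range_subset_range.2 (Nat.sub_le (n + 1) i))]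
    · refine Finset.sum_congr rfl fun j _ => ?_
      rw [smul_mul_smul_comm, hP, map_smul, smul_eq_mul]
    · intro j _ hj
      have : n < i + j := by
        have := Finset.mem_range.1 hi
        simp at hj
        omega
      rw [smul_mul_smul_comm, hP, map_smul, hP0 _ this, smul_zero]
  -- Pairs with `i + j > n` are gone; the remaining triangle is summed along `r = i + j`.
  rw [Finset.sum_congr rfl h2, ← Finset.sum_range_diag_flip (n + 1)
    fun i j => (c x i * c y j) * PowerSeries.coeff n (P (a + b + 1) (i + j))]
  refine Finset.sum_congr rfl fun r _ => ?_
  rw [map_smul, smul_eq_mul, ← hcc, Finset.sum_mul]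
  refine Finset.sum_congr rfl fun k hk => ?_
  have hk' : k ≤ r := Nat.lt_succ_iff.1 (Finset.mem_range.1 hk)
  rw [Nat.add_sub_cancel' hk']

theorem prod_laguerreSeries (d : ℕ) (t : Fin (d + 1) → ℝ) :
    ∏ i, laguerreSeries 0 (t i) = laguerreSeries d (∑ i, t i) := by
  induction d with
  | zero => simp
  | succ d ih =>
    rw [Fin.prod_univ_castSucc, ih, laguerreSeries_mul, Fin.sum_univ_castSucc (n := d + 1)]

theorem sum_prod_laguerre {d : ℕ} (hd : 1 ≤ d) (n : ℕ) (t : Fin d → ℝ) :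
    ∑ k ∈ Finset.finsuppAntidiag Finset.univ n, ∏ i, laguerre 0 (k i) (t i)
      = laguerre (d - 1) n (∑ i, t i) := by
  obtain ⟨d, rfl⟩ := Nat.exists_eq_add_of_le' hd
  have := congrArg (PowerSeries.coeff n) (prod_laguerreSeries d t)
  rw [PowerSeries.coeff_prod] at this
  simpa [laguerreSeries] using this

/-- Set all `t_i = 0` in the preceding identity: each factor of type 0 equals 1 there. -/
theorem card_finsuppAntidiag_fin {d : ℕ} (hd : 1 ≤ d) (n : ℕ) :
    ((Finset.finsuppAntidiag (Finset.univ : Finset (Fin d)) n).card : ℝ)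
      = ((d - 1 + n).choose n : ℝ) := by
  have := sum_prod_laguerre hd n (fun _ => 0)
  simpa [laguerre_at_zero, add_comm] using this

/-! ### Hermite polynomials and Gaussian integrals -/

open Polynomial in
theorem derivative_hermite_succ (n : ℕ) :
    derivative (hermite (n + 1)) = ((n : ℤ[X]) + 1) * hermite n := by
  induction n with
  | zero => simp [hermite_succ]
  | succ n ih =>
    rw [hermite_succ (n + 1), derivative_sub, derivative_mul, derivative_X, ih, derivative_mul]
    have : derivative ((n : ℤ[X]) + 1) = 0 := by
      rw [derivative_add, derivative_natCast, derivative_one, add_zero]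
    rw [this, hermite_succ n]
    push_cast
    ring

/-- The translate `He_k(X + α)` of a Hermite polynomial, with complex coefficients. -/
def hermiteShift (α : ℂ) (k : ℕ) : Polynomial ℂ :=
  ((Polynomial.hermite k).map (Int.castRingHom ℂ)).comp (Polynomial.X + Polynomial.C α)

open Polynomial in
theorem hermiteShift_zero (α : ℂ) : hermiteShift α 0 = 1 := by
  simp [hermiteShift]

open Polynomial in
theorem derivative_hermiteShift (α : ℂ) (k : ℕ) :
    derivative (hermiteShift α k) = C (k : ℂ) * hermiteShift α (k - 1) := by
  cases k with
  | zero => simp [hermiteShift_zero]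
  | succ k =>
    rw [hermiteShift, derivative_comp, derivative_map, derivative_hermite_succ]
    simp [hermiteShift]

open Polynomial in
theorem hermiteShift_succ (α : ℂ) (k : ℕ) :
    hermiteShift α (k + 1)
      = X * hermiteShift α k + C α * hermiteShift α k - derivative (hermiteShift α k) := by
  have : derivative (hermiteShift α k)
      = (((derivative (hermite k)).map (Int.castRingHom ℂ)).comp (X + C α)) := by
    rw [hermiteShift, derivative_comp, derivative_map]
    simp
  rw [this, hermiteShift, hermite_succ]
  simp [hermiteShift, add_mul]

open Polynomial in
-- The hypothesis on `L` is Gaussian integration by parts, so `X - d/dX` is adjoint to `d/dX`.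
-- Moving the `k` raising operators off the first factor applies `(α + d/dX)^k` to the second.
-- Derivatives act on `He_l(X + β)` as on `X^l`, and `L` sends `He_l(X + β)` to `L 1 * β^l`.
theorem gaussian_functional_hermiteShift (L : ℂ[X] →ₗ[ℂ] ℂ)
    (hL : ∀ Q, L (X * Q) = L (derivative Q)) (α β : ℂ) (k l : ℕ) :
    L (hermiteShift α k * hermiteShift β l)
      = L 1 * eval β (((algebraMap ℂ (Module.End ℂ ℂ[X]) α + derivative : Module.End ℂ ℂ[X]) ^ k)
          (X ^ l)) := by
  induction k generalizing l with
  | zero =>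
    rw [hermiteShift_zero, one_mul, pow_zero, Module.End.one_apply, eval_pow, eval_X]
    induction l with
    | zero => simp [hermiteShift_zero]
    | succ l ih =>
      rw [hermiteShift_succ, map_sub, map_add, hL, add_sub_cancel_left, C_mul', map_smul, ih,
        smul_eq_mul]
      ring
  | succ k ih =>
    have h1 : hermiteShift α (k + 1) * hermiteShift β l
        = X * (hermiteShift α k * hermiteShift β l) + α • (hermiteShift α k * hermiteShift β l)
          - derivative (hermiteShift α k) * hermiteShift β l := by
      rw [hermiteShift_succ, smul_eq_C_mul]
      ring
    have h2 : ((algebraMap ℂ (Module.End ℂ ℂ[X]) α + derivative : Module.End ℂ ℂ[X])) (X ^ l)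
        = α • X ^ l + (l : ℂ) • X ^ (l - 1) := by
      rw [LinearMap.add_apply, Module.algebraMap_end_apply, derivative_X_pow, smul_eq_C_mul (l : ℂ)]
    rw [h1, map_sub, map_add, hL, derivative_mul, derivative_hermiteShift β, map_add,
      pow_succ, Module.End.mul_apply, h2, map_add, map_smul, map_smul, map_smul, eval_add,
      eval_smul, eval_smul, mul_left_comm, C_mul', map_smul, ih, ih]
    simp only [smul_eq_mul]
    ring

open Polynomial in
-- Expanding `(α + d/dX)^k X^k` at `β` leaves only powers of `αβ = -t`, with Laguerre coefficients.
theorem gaussian_functional_hermiteShift_self (L : ℂ[X] →ₗ[ℂ] ℂ)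
    (hL : ∀ Q, L (X * Q) = L (derivative Q)) (α β : ℂ) (t : ℝ) (h : α * β = -(t : ℂ)) (k : ℕ) :
    L (hermiteShift α k * hermiteShift β k) = L 1 * (k.factorial * laguerre 0 k t : ℝ) := by
  rw [gaussian_functional_hermiteShift L hL]
  congr 1
  have hc : Commute (algebraMap ℂ (Module.End ℂ ℂ[X]) α) (derivative : Module.End ℂ ℂ[X]) :=
    Algebra.commutes α _
  rw [hc.add_pow, LinearMap.sum_apply, eval_finsetSum, laguerre, Finset.mul_sum]
  push_cast
  refine Finset.sum_congr rfl fun i hi => ?_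
  have hi' : i ≤ k := Nat.lt_succ_iff.1 (Finset.mem_range.1 hi)
  have h1 : (i.factorial : ℂ) ≠ 0 := by exact_mod_cast i.factorial_ne_zero
  have h2 : (i.factorial : ℂ) * (k.descFactorial (k - i) : ℂ) = k.factorial := by
    have := Nat.factorial_mul_descFactorial (Nat.sub_le k i)
    rw [Nat.sub_sub_self hi'] at this
    exact_mod_cast this
  rw [← map_pow, Module.End.mul_apply, Module.End.mul_apply, Module.algebraMap_end_apply,
    Module.End.natCast_apply, map_nsmul, Module.End.pow_apply, iterate_derivative_X_pow_eq_smul,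
    Nat.sub_sub_self hi', eval_smul, eval_smul, eval_smul, eval_pow, eval_X, ← h2, add_zero,
    Nat.choose_symm hi', smul_eq_mul, smul_eq_mul, nsmul_eq_mul, neg_eq_neg_one_mul] at *
  field_simp
  linear_combination (k.choose i : ℂ) * congrArg (· ^ i) h

theorem integrable_polynomial_mul_gaussian (c : ℂ) (P : Polynomial ℂ) :
    MeasureTheory.Integrable fun q : ℝ => P.eval (q : ℂ) * Complex.exp (-(q : ℂ) ^ 2 + 2 * c * q) := by
  induction P using Polynomial.induction_on' with
  | add p q hp hq =>
    simp only [Polynomial.eval_add, add_mul]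
    exact hp.add hq
  | monomial n a =>
    simp only [Polynomial.eval_monomial, mul_assoc]
    refine MeasureTheory.Integrable.const_mul ?_ a
    -- The term `2|re c|` absorbs the linear exponent and the extra 1 absorbs `|q|^n ≤ n! exp |q|`;
    -- the signs `±K` serve the two half-lines.
    set K : ℝ := 1 + 2 * |c.re|
    have h1 := (integrable_cexp_quadratic (b := 1) (by simp) (K : ℂ) 0).norm
    have h2 := (integrable_cexp_quadratic (b := 1) (by simp) (-K : ℂ) 0).norm
    refine ((h1.add h2).const_mul (n.factorial : ℝ)).mono' (by fun_prop) (Filter.Eventually.of_forall ?_)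
    intro q
    have e1 : ‖Complex.exp (-1 * (q : ℂ) ^ 2 + K * q + 0)‖ = Real.exp (-q ^ 2 + K * q) := by
      rw [Complex.norm_exp]
      congr 1
      simp [pow_two]
    have e2 : ‖Complex.exp (-1 * (q : ℂ) ^ 2 + -K * q + 0)‖ = Real.exp (-q ^ 2 - K * q) := by
      rw [Complex.norm_exp]
      congr 1
      simp [pow_two]
      ring
    have e3 : ‖Complex.exp (-(q : ℂ) ^ 2 + 2 * (c * q))‖ = Real.exp (-q ^ 2 + 2 * (c.re * q)) := by
      rw [Complex.norm_exp]
      congr 1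
      simp [pow_two]
    have e4 : |q| ^ n ≤ n.factorial * Real.exp |q| := by
      have := Real.pow_div_factorial_le_exp |q| (abs_nonneg q) n
      rwa [div_le_iff₀' (by positivity)] at this
    have e5 : Real.exp (-q ^ 2 + 2 * (c.re * q) + |q|)
        ≤ Real.exp (-q ^ 2 + K * q) + Real.exp (-q ^ 2 - K * q) := by
      have h3 : c.re * q ≤ |c.re| * |q| := by
        rw [← abs_mul]
        exact le_abs_self _
      rcases le_total 0 q with hq | hq
      · rw [abs_of_nonneg hq] at *
        refine le_trans (Real.exp_le_exp.2 ?_) (le_add_of_nonneg_right (Real.exp_pos _).le)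
        simp only [K]
        linarith
      · rw [abs_of_nonpos hq] at *
        refine le_trans (Real.exp_le_exp.2 ?_) (le_add_of_nonneg_left (Real.exp_pos _).le)
        simp only [K]
        linarith
    simp only [Pi.add_apply]
    rw [e1, e2, norm_mul, norm_pow, Complex.norm_real, Real.norm_eq_abs, e3]
    calc |q| ^ n * Real.exp (-q ^ 2 + 2 * (c.re * q))
        ≤ (n.factorial * Real.exp |q|) * Real.exp (-q ^ 2 + 2 * (c.re * q)) := by gcongr
      _ = n.factorial * Real.exp (-q ^ 2 + 2 * (c.re * q) + |q|) := by
          rw [mul_assoc, ← Real.exp_add]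
          ring_nf
      _ ≤ _ := by gcongr

/-- The functional `Q ↦ ∫ Q(√2 (q - c)) exp(-q² + 2 c q) dq`, a multiple of the standard Gaussian
expectation. -/
def gaussianFunctional (c : ℂ) : Polynomial ℂ →ₗ[ℂ] ℂ where
  toFun Q := ∫ q : ℝ, (Q.comp (Polynomial.C (Real.sqrt 2 : ℂ) * (Polynomial.X - Polynomial.C c))).eval
    (q : ℂ) * Complex.exp (-(q : ℂ) ^ 2 + 2 * c * q)
  map_add' P Q := by
    rw [← MeasureTheory.integral_add (integrable_polynomial_mul_gaussian c _)
      (integrable_polynomial_mul_gaussian c _)]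
    simp only [Polynomial.add_comp, Polynomial.eval_add, add_mul]
  map_smul' a P := by
    rw [RingHom.id_apply, ← MeasureTheory.integral_smul]
    simp only [Polynomial.smul_comp, Polynomial.eval_smul, smul_eq_mul, mul_assoc]

theorem gaussianFunctional_one (c : ℂ) :
    gaussianFunctional c 1 = Real.sqrt Real.pi * Complex.exp (c ^ 2) := by
  have h := integral_cexp_quadratic (b := -1) (by simp) (2 * c) 0
  simp only [gaussianFunctional, LinearMap.coe_mk, AddHom.coe_mk, Polynomial.one_comp,
    Polynomial.eval_one, one_mul]
  have h2 : (Real.sqrt Real.pi : ℂ) = ((Real.pi : ℂ) / - -1) ^ (1 / 2 : ℂ) := by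
    rw [Real.sqrt_eq_rpow, Complex.ofReal_cpow Real.pi_pos.le]
    norm_num
  have h3 : c ^ 2 = 0 - (2 * c) ^ 2 / (4 * -1) := by ring
  rw [h2, h3, ← h]
  simp

open Polynomial in
-- The weight has logarithmic derivative `-2(q - c)`, which is `-√2` times the substituted variable;
-- the integral of a total derivative vanishes. No contour shift is needed for complex `c`.
theorem gaussianFunctional_X_mul (c : ℂ) (Q : ℂ[X]) :
    gaussianFunctional c (X * Q) = gaussianFunctional c (derivative Q) := by
  set A : ℂ[X] := C (Real.sqrt 2 : ℂ) * (X - C c)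
  set P : ℂ[X] := Q.comp A
  have hA : derivative A = C (Real.sqrt 2 : ℂ) := by simp [A]
  have hs : (Real.sqrt 2 : ℂ) * Real.sqrt 2 = 2 := by
    rw [← Complex.ofReal_mul, Real.mul_self_sqrt (by norm_num)]
    norm_num
  have hs0 : (Real.sqrt 2 : ℂ) ≠ 0 := by
    intro h
    rw [h] at hs
    norm_num at hs
  have hint : ∫ q : ℝ, (derivative P - C 2 * (X - C c) * P).eval (q : ℂ)
      * Complex.exp (-(q : ℂ) ^ 2 + 2 * c * q) = 0 := by
    refine MeasureTheory.integral_eq_zero_of_hasDerivAt_of_integrable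
      (f := fun q : ℝ => P.eval (q : ℂ) * Complex.exp (-(q : ℂ) ^ 2 + 2 * c * q)) ?_
      (integrable_polynomial_mul_gaussian c _) (integrable_polynomial_mul_gaussian c _)
    intro q
    have h1 : HasDerivAt (fun z : ℂ => P.eval z * Complex.exp (-z ^ 2 + 2 * c * z))
        ((derivative P).eval (q : ℂ) * Complex.exp (-(q : ℂ) ^ 2 + 2 * c * q)
          + P.eval (q : ℂ) * (Complex.exp (-(q : ℂ) ^ 2 + 2 * c * q) * (-(2 * q) + 2 * c))) q := by
      refine (P.hasDerivAt _).mul (HasDerivAt.cexp ?_)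
      have := ((hasDerivAt_pow 2 (q : ℂ)).fun_neg).fun_add ((hasDerivAt_id (q : ℂ)).const_mul (2 * c))
      simpa using this
    have h2 : (derivative P - C 2 * (X - C c) * P).eval (q : ℂ)
        * Complex.exp (-(q : ℂ) ^ 2 + 2 * c * q)
        = (derivative P).eval (q : ℂ) * Complex.exp (-(q : ℂ) ^ 2 + 2 * c * q)
          + P.eval (q : ℂ) * (Complex.exp (-(q : ℂ) ^ 2 + 2 * c * q) * (-(2 * q) + 2 * c)) := by
      simp only [eval_sub, eval_mul, eval_C, eval_X]
      ring
    rw [h2]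
    exact h1.comp_ofReal
  have h2 : derivative P - C 2 * (X - C c) * P
      = C (Real.sqrt 2 : ℂ) * ((derivative Q).comp A - (X * Q).comp A) := by
    rw [show derivative P = derivative A * (derivative Q).comp A from derivative_comp _ _, hA,
      mul_comp, X_comp, ← hs, C_mul]
    simp only [A, P]
    ring
  have h3 : ∫ q : ℝ, (C (Real.sqrt 2 : ℂ) * ((derivative Q).comp A - (X * Q).comp A)).eval (q : ℂ)
      * Complex.exp (-(q : ℂ) ^ 2 + 2 * c * q)
      = Real.sqrt 2 * (gaussianFunctional c (derivative Q) - gaussianFunctional c (X * Q)) := by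
    simp only [gaussianFunctional, LinearMap.coe_mk, AddHom.coe_mk]
    rw [← MeasureTheory.integral_sub (integrable_polynomial_mul_gaussian c _)
      (integrable_polynomial_mul_gaussian c _), ← MeasureTheory.integral_const_mul]
    refine MeasureTheory.integral_congr_ae (Filter.Eventually.of_forall fun q => ?_)
    simp [A]
    ring
  rw [← h2, hint] at h3
  have := (mul_eq_zero.1 h3.symm).resolve_left hs0
  exact (sub_eq_zero.1 this).symm

/-- Completing the square with `c = (iX - Y)/2` makes the two Gaussians and the character a multiple
of `exp(-q² + 2cq)`. In the variable `√2(q - c)` the Hermite polynomials are shifted by `√2 c` and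
`√2(c + Y)`, whose product is `-(X² + Y²)/2`. -/
theorem integral_hermiteFun_mul_shift (X Y : ℝ) (k : ℕ) :
    ∫ q : ℝ, (hermiteFun k q : ℂ) * Complex.exp (Complex.I * (X * q + X * Y / 2 : ℝ))
      * (hermiteFun k (q + Y) : ℂ)
      = (Real.exp (-(X ^ 2 + Y ^ 2) / 4) * laguerre 0 k ((X ^ 2 + Y ^ 2) / 2) : ℝ) := by
  set c : ℂ := (Complex.I * X - Y) / 2
  obtain ⟨K, hKdef⟩ :
      ∃ K : ℂ, K = (((Real.sqrt ((k.factorial : ℝ) * Real.sqrt Real.pi))⁻¹ : ℝ) : ℂ) := ⟨_, rfl⟩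
  have hη : ∀ z : ℝ, (hermiteFun k z : ℂ)
      = K * (Polynomial.aeval (Real.sqrt 2 * z) (Polynomial.hermite k) : ℝ)
        * Complex.exp ((-z ^ 2 / 2 : ℝ) : ℂ) := by
    intro z
    rw [hermiteFun, hKdef, ← Complex.ofReal_exp, Complex.ofReal_mul, Complex.ofReal_mul]
  have hs : (Real.sqrt 2 : ℂ) * Real.sqrt 2 = 2 := by
    rw [← Complex.ofReal_mul, Real.mul_self_sqrt (by norm_num)]
    norm_num
  have hab : (Real.sqrt 2 * c) * (Real.sqrt 2 * (c + Y)) = -(((X ^ 2 + Y ^ 2) / 2 : ℝ) : ℂ) := by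
    have : (Real.sqrt 2 * c) * (Real.sqrt 2 * (c + Y)) = 2 * (c * (c + Y)) := by rw [← hs]; ring
    rw [this]
    simp only [c]
    push_cast
    linear_combination (X ^ 2 / 2 : ℂ) * Complex.I_sq
  have hev : ∀ (z : ℝ) (w : ℂ), w = (Real.sqrt 2 * z : ℝ) →
      ((Polynomial.hermite k).map (Int.castRingHom ℂ)).eval w
        = (Polynomial.aeval (Real.sqrt 2 * z) (Polynomial.hermite k) : ℝ) := by
    rintro z w rfl
    rw [Polynomial.eval_map]
    exact Polynomial.aeval_algebraMap_apply ℂ (Real.sqrt 2 * z) (Polynomial.hermite k)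
  have key := gaussian_functional_hermiteShift_self (gaussianFunctional c)
    (gaussianFunctional_X_mul c) _ _ _ hab k
  have hK : K * K * (k.factorial * Real.sqrt Real.pi : ℝ) = 1 := by
    have hpos : (0 : ℝ) < (k.factorial : ℝ) * Real.sqrt Real.pi := by positivity
    rw [hKdef, ← Complex.ofReal_mul, ← Complex.ofReal_mul, ← mul_inv, Real.mul_self_sqrt hpos.le,
      inv_mul_cancel₀ hpos.ne', Complex.ofReal_one]
  have h1 : ∀ q : ℝ, (hermiteFun k q : ℂ) * Complex.exp (Complex.I * (X * q + X * Y / 2 : ℝ))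
      * (hermiteFun k (q + Y) : ℂ) = (K * K * Complex.exp (Complex.I * X * Y / 2 - Y ^ 2 / 2)) *
      (((hermiteShift (Real.sqrt 2 * c) k * hermiteShift (Real.sqrt 2 * (c + Y)) k).comp
        (Polynomial.C (Real.sqrt 2 : ℂ) * (Polynomial.X - Polynomial.C c))).eval (q : ℂ)
        * Complex.exp (-(q : ℂ) ^ 2 + 2 * c * q)) := by
    intro q
    have e1 : Complex.exp ((-q ^ 2 / 2 : ℝ) : ℂ) * Complex.exp (Complex.I * (X * q + X * Y / 2 : ℝ))
        * Complex.exp ((-(q + Y) ^ 2 / 2 : ℝ) : ℂ)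
        = Complex.exp (Complex.I * X * Y / 2 - Y ^ 2 / 2) * Complex.exp (-(q : ℂ) ^ 2 + 2 * c * q) := by
      rw [← Complex.exp_add, ← Complex.exp_add, ← Complex.exp_add]
      congr 1
      simp only [c]
      push_cast
      ring
    rw [Polynomial.mul_comp, Polynomial.eval_mul, hermiteShift, hermiteShift, Polynomial.eval_comp,
      Polynomial.eval_comp, Polynomial.eval_comp, Polynomial.eval_comp, hev q, hev (q + Y)]
    · rw [hη, hη]
      linear_combination (K * K * (Polynomial.aeval (Real.sqrt 2 * q) (Polynomial.hermite k) : ℝ)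
        * (Polynomial.aeval (Real.sqrt 2 * (q + Y)) (Polynomial.hermite k) : ℝ)) * e1
    · simp
      ring
    · simp
      ring
  simp_rw [h1]
  rw [MeasureTheory.integral_const_mul]
  change _ * gaussianFunctional c _ = _
  rw [key, gaussianFunctional_one]
  have e2 : Complex.exp (Complex.I * X * Y / 2 - Y ^ 2 / 2) * Complex.exp (c ^ 2)
      = Complex.exp ((-(X ^ 2 + Y ^ 2) / 4 : ℝ) : ℂ) := by
    rw [← Complex.exp_add]
    congr 1
    simp only [c]
    push_cast
    linear_combination (X ^ 2 / 4 : ℂ) * Complex.I_sq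
  push_cast at e2 hK ⊢
  rw [← e2]
  linear_combination (Complex.exp (Complex.I * X * Y / 2 - Y ^ 2 / 2) * Complex.exp (c ^ 2)
    * laguerre 0 k ((X ^ 2 + Y ^ 2) / 2)) * hK

/-! ### Diagonal matrix coefficients of the Schrödinger representation -/

theorem integral_hermiteFun_scaled (k : ℕ) {lam : ℝ} (hl : lam ≠ 0) (x y : ℝ) :
    ∫ q : ℝ, (Real.sqrt |lam| : ℂ) * ((hermiteFun k (Real.sqrt |lam| * q) : ℂ)
      * Complex.exp (Complex.I * (lam * (x * q + x * y / 2) : ℝ))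
      * (hermiteFun k (Real.sqrt |lam| * (q + y)) : ℂ))
      = (Real.exp (-(|lam| * (x ^ 2 + y ^ 2)) / 4)
          * laguerre 0 k (|lam| * (x ^ 2 + y ^ 2) / 2) : ℝ) := by
  set r := Real.sqrt |lam|
  have hr : 0 < r := Real.sqrt_pos.2 (abs_pos.2 hl)
  have hrr : r ^ 2 = |lam| := Real.sq_sqrt (abs_nonneg _)
  have hr0 : (r : ℂ) ≠ 0 := by exact_mod_cast hr.ne'
  -- Rescaling `q` by `r = √|λ|` gives these parameters; either sign of `λ` works because only
  -- `λ²/r² = |λ|` enters.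
  have h := integral_hermiteFun_mul_shift (lam * x / r) (r * y) k
  have hXY : (lam * x / r) ^ 2 + (r * y) ^ 2 = |lam| * (x ^ 2 + y ^ 2) := by
    have : lam ^ 2 = r ^ 2 * r ^ 2 := by rw [hrr, ← pow_two, sq_abs]
    rw [div_pow, mul_pow, this, mul_pow, ← hrr]
    field_simp
  rw [hXY] at h
  rw [← h]
  have h2 := MeasureTheory.Measure.integral_comp_mul_left (fun q : ℝ => (hermiteFun k q : ℂ)
    * Complex.exp (Complex.I * (lam * x / r * q + lam * x / r * (r * y) / 2 : ℝ))
    * (hermiteFun k (q + r * y) : ℂ)) r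
  rw [abs_of_pos (inv_pos.2 hr), Complex.real_smul, Complex.ofReal_inv,
    eq_inv_mul_iff_mul_eq₀ hr0] at h2
  rw [← h2, MeasureTheory.integral_const_mul]
  congr 1
  refine MeasureTheory.integral_congr_ae (Filter.Eventually.of_forall fun q => ?_)
  have e1 : lam * (x * q + x * y / 2) = lam * x / r * (r * q) + lam * x / r * (r * y) / 2 := by
    field_simp
  simp only
  rw [e1, mul_add r q y]

/-- `|z_i|² = x_i² + y_i²`. -/
def coordNormSq {d : ℕ} (i : Fin d) (v : Pt d) : ℝ := v.1 i ^ 2 + v.2.1 i ^ 2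

/-- The integrand factors over coordinates: `|λ|^(d/2)` supplies one `√|λ|` to each one-dimensional
integral. -/
theorem matrixCoeff_self {d : ℕ} (k : Fin d → ℕ) {lam : ℝ} (hl : lam ≠ 0) (v : Pt d) :
    matrixCoeff k k lam v = Complex.exp (Complex.I * (lam * v.2.2 : ℝ)) *
      ((Real.exp (-(|lam| * zNormSq v) / 4) * ∏ i, laguerre 0 (k i) (|lam| * coordNormSq i v / 2) : ℝ) : ℂ) := by
  have h1 : ∀ q : Fin d → ℝ, starRingEnd ℂ (hermiteScaled k lam q)
      * schrodinger lam v (hermiteScaled k lam) q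
      = Complex.exp (Complex.I * (lam * v.2.2 : ℝ)) * ∏ i, (Real.sqrt |lam| : ℂ) *
        ((hermiteFun (k i) (Real.sqrt |lam| * q i) : ℂ)
        * Complex.exp (Complex.I * (lam * (v.1 i * q i + v.1 i * v.2.1 i / 2) : ℝ))
        * (hermiteFun (k i) (Real.sqrt |lam| * (q i + v.2.1 i)) : ℂ)) := by
    intro q
    have hpow : (|lam| ^ ((d : ℝ) / 4) : ℝ) * |lam| ^ ((d : ℝ) / 4) = Real.sqrt |lam| ^ d := by
      rw [← Real.rpow_add (abs_pos.2 hl), Real.sqrt_eq_rpow, ← Real.rpow_mul_natCast (abs_nonneg _)]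
      congr 1
      ring
    have hexp : Complex.exp (Complex.I * ((lam * (v.2.2 + ∑ i, v.1 i * q i
          + (∑ i, v.1 i * v.2.1 i) / 2) : ℝ) : ℂ))
        = Complex.exp (Complex.I * (lam * v.2.2 : ℝ))
          * ∏ i, Complex.exp (Complex.I * (lam * (v.1 i * q i + v.1 i * v.2.1 i / 2) : ℝ)) := by
      rw [← Complex.exp_sum, ← Complex.exp_add]
      congr 1
      rw [← Finset.mul_sum, ← Complex.ofReal_sum, ← Finset.mul_sum, Finset.sum_add_distrib,
        Finset.sum_div]
      push_cast
      ring
    have hpow' : (((|lam| ^ ((d : ℝ) / 4) : ℝ) : ℂ)) * ((|lam| ^ ((d : ℝ) / 4) : ℝ) : ℂ)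
        = (Real.sqrt |lam| : ℂ) ^ d := by
      rw [← Complex.ofReal_mul, hpow, Complex.ofReal_pow]
    rw [schrodinger, hexp, hermiteScaled, hermiteScaled, Complex.conj_ofReal, Finset.prod_mul_distrib,
      Finset.prod_mul_distrib, Finset.prod_mul_distrib, Finset.prod_const, Finset.card_univ,
      Fintype.card_fin, ← hpow']
    simp only [Pi.add_apply, Complex.ofReal_mul, Complex.ofReal_prod]
    ring
  rw [matrixCoeff]
  simp_rw [h1]
  rw [MeasureTheory.integral_const_mul, MeasureTheory.integral_fintype_prod_volume_eq_prod
    (f := fun i q => (Real.sqrt |lam| : ℂ) *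
        ((hermiteFun (k i) (Real.sqrt |lam| * q) : ℂ)
        * Complex.exp (Complex.I * (lam * (v.1 i * q + v.1 i * v.2.1 i / 2) : ℝ))
        * (hermiteFun (k i) (Real.sqrt |lam| * (q + v.2.1 i)) : ℂ)))]
  congr 1
  simp_rw [integral_hermiteFun_scaled _ hl]
  rw [← Complex.ofReal_prod, Finset.prod_mul_distrib, ← Real.exp_sum]
  congr 4
  rw [zNormSq, Finset.mul_sum, ← Finset.sum_neg_distrib, Finset.sum_div]

theorem conj_ell {d : ℕ} (n : ℕ) (lam : ℝ) (v : Pt d) :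
    starRingEnd ℂ (ell n lam v) = (((d - 1 + n).choose n : ℝ)⁻¹ : ℝ)
      * (Complex.exp (Complex.I * (lam * v.2.2 : ℝ)) * ((Real.exp (-(|lam| * zNormSq v) / 4)
        * laguerre (d - 1) n (|lam| * zNormSq v / 2) : ℝ) : ℂ)) := by
  rw [ell, map_mul, map_mul, Complex.conj_ofReal, Complex.conj_ofReal, ← Complex.exp_conj, map_sub,
    map_mul, map_neg, Complex.conj_I, Complex.conj_ofReal, Complex.conj_ofReal, neg_neg,
    sub_eq_add_neg, Complex.exp_add, Complex.ofReal_mul (Real.exp _), Complex.ofReal_exp]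
  push_cast
  ring_nf

/-- The left side is the trace of the representation over one eigenspace of `H_λ`; this links the
Fourier matrix to the biradial transform. -/
theorem sum_matrixCoeff_self {d : ℕ} (hd : 1 ≤ d) (n : ℕ) {lam : ℝ} (hl : lam ≠ 0) (v : Pt d) :
    ∑ k ∈ Finset.finsuppAntidiag Finset.univ n, matrixCoeff (⇑k) (⇑k) lam v
      = ((d - 1 + n).choose n : ℝ) * starRingEnd ℂ (ell n lam v) := by
  have hc : (((d - 1 + n).choose n : ℝ) : ℂ) ≠ 0 := by
    exact_mod_cast (Nat.choose_pos (Nat.le_add_left n (d - 1))).ne'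
  rw [conj_ell, Complex.ofReal_inv, mul_inv_cancel_left₀ hc]
  simp_rw [matrixCoeff_self _ hl]
  rw [← Finset.mul_sum, ← Complex.ofReal_sum, ← Finset.mul_sum, sum_prod_laguerre hd]
  congr 4
  rw [zNormSq, Finset.mul_sum, Finset.sum_div]
  rfl

/-! ### Test functions in the frequency variable -/

theorem IsFreqTest.eventually_eq_zero {ψ : ℝ → ℂ} (hψ : IsFreqTest ψ) : ψ =ᶠ[nhds 0] 0 :=
  notMem_tsupport_iff_eventuallyEq.1 hψ.away

theorem IsFreqTest.apply_zero {ψ : ℝ → ℂ} (hψ : IsFreqTest ψ) : ψ 0 = 0 :=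
  hψ.eventually_eq_zero.self_of_nhds

/-- Test functions vanish near 0, so they absorb multipliers singular there, such as `1/λ` or
`|λ|^i`. -/
theorem IsFreqTest.mul {ψ c : ℝ → ℂ} (hψ : IsFreqTest ψ) (hc : ContDiffOn ℝ ∞ c {0}ᶜ) :
    IsFreqTest fun lam => c lam * ψ lam where
  smooth := by
    rw [contDiff_iff_contDiffAt]
    intro x
    by_cases hx : x = 0
    · subst hx
      refine (contDiffAt_const (c := (0 : ℂ))).congr_of_eventuallyEq ?_
      filter_upwards [hψ.eventually_eq_zero] with y hy
      rw [hy, Pi.zero_apply, mul_zero]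
    · exact (hc.contDiffAt (isOpen_compl_singleton.mem_nhds hx)).mul hψ.smooth.contDiffAt
  compact := hψ.compact.mul_left
  away h := hψ.away (tsupport_mul_subset_right h)

theorem IsFreqTest.deriv {ψ : ℝ → ℂ} (hψ : IsFreqTest ψ) : IsFreqTest (deriv ψ) where
  smooth := (contDiff_infty_iff_deriv.1 hψ.smooth).2
  compact := hψ.compact.deriv
  away h := hψ.away (tsupport_deriv_subset h)

theorem IsFreqTest.continuous_mul {ψ F : ℝ → ℂ} (hψ : IsFreqTest ψ) (hF : ContinuousOn F {0}ᶜ) :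
    Continuous fun lam => ψ lam * F lam := by
  rw [continuous_iff_continuousAt]
  intro x
  by_cases hx : x = 0
  · subst hx
    refine (continuousAt_const (y := (0 : ℂ))).congr ?_
    filter_upwards [hψ.eventually_eq_zero] with y hy
    rw [hy, Pi.zero_apply, zero_mul]
  · exact hψ.smooth.continuous.continuousAt.mul (hF.continuousAt (isOpen_compl_singleton.mem_nhds hx))

theorem IsFreqTest.integrable_mul {ψ F : ℝ → ℂ} (hψ : IsFreqTest ψ) (hF : ContinuousOn F {0}ᶜ) :
    MeasureTheory.Integrable fun lam => ψ lam * F lam :=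
  (hψ.continuous_mul hF).integrable_of_hasCompactSupport hψ.compact.mul_right

theorem IsFreqTest.integral_mul_deriv {ψ F F' : ℝ → ℂ} (hψ : IsFreqTest ψ)
    (hF : ∀ lam, lam ≠ 0 → HasDerivAt F (F' lam) lam) (hF' : ContinuousOn F' {0}ᶜ) :
    ∫ lam, ψ lam * F' lam = -∫ lam, _root_.deriv ψ lam * F lam := by
  have hFc : ContinuousOn F {0}ᶜ := fun x hx => (hF x hx).continuousAt.continuousWithinAt
  have h1 := hψ.deriv.integrable_mul hFc
  have h2 := hψ.integrable_mul hF'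
  have h := MeasureTheory.integral_eq_zero_of_hasDerivAt_of_integrable
    (f := fun lam => ψ lam * F lam) (f' := fun lam => _root_.deriv ψ lam * F lam + ψ lam * F' lam)
    (fun x => ?_) (h1.add h2) (hψ.integrable_mul hFc)
  · rw [MeasureTheory.integral_add h1 h2] at h
    exact eq_neg_of_add_eq_zero_right h
  · by_cases hx : x = 0
    · subst hx
      rw [hψ.deriv.apply_zero, hψ.apply_zero, zero_mul, zero_mul, zero_add]
      refine (hasDerivAt_const (0 : ℝ) (0 : ℂ)).congr_of_eventuallyEq ?_
      filter_upwards [hψ.eventually_eq_zero] with y hy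
      rw [hy, Pi.zero_apply, zero_mul]
    · exact ((hψ.smooth.differentiable (by simp) x).hasDerivAt).mul (hF x hx)

theorem contDiffOn_ite_pos {c₁ c₂ : ℝ → ℂ} (h₁ : ContDiffOn ℝ ∞ c₁ {0}ᶜ)
    (h₂ : ContDiffOn ℝ ∞ c₂ {0}ᶜ) :
    ContDiffOn ℝ ∞ (fun lam => if 0 < lam then c₁ lam else c₂ lam) {0}ᶜ := by
  intro x hx
  rcases lt_or_gt_of_ne (show x ≠ 0 from hx) with h | h
  · refine (h₂ x hx).congr_of_eventuallyEq ?_ (if_neg h.not_gt)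
    filter_upwards [mem_nhdsWithin_of_mem_nhds (Iio_mem_nhds h)] with y hy
    exact if_neg (not_lt.2 (le_of_lt hy))
  · refine (h₁ x hx).congr_of_eventuallyEq ?_ (if_pos h)
    filter_upwards [mem_nhdsWithin_of_mem_nhds (Ioi_mem_nhds h)] with y hy
    exact if_pos hy

theorem contDiffOn_abs_pow (i : ℕ) : ContDiffOn ℝ ∞ (fun lam : ℝ => ((|lam| ^ i : ℝ) : ℂ)) {0}ᶜ := by
  intro x hx
  exact (Complex.ofRealCLM.contDiff.contDiffAt.comp x ((contDiffAt_abs hx).pow i)).contDiffWithinAt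

/-! ### Rapidly decaying functions -/

section Kernels

variable {d : ℕ}

/-- Measurable functions on the Heisenberg group that decay faster than any power. -/
structure RapidDecay (h : Pt d → ℂ) : Prop where
  meas : MeasureTheory.AEStronglyMeasurable h MeasureTheory.volume
  bound : ∀ M : ℕ, ∃ C : ℝ, ∀ v, ‖h v‖ * (1 + ‖v‖) ^ M ≤ C

/-- Continuous functions on the Heisenberg group of at most polynomial growth. -/
structure PolyGrowth (p : Pt d → ℂ) : Prop where
  cont : Continuous p
  bound : ∃ (K : ℕ) (C : ℝ), ∀ v, ‖p v‖ ≤ C * (1 + ‖v‖) ^ K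

theorem RapidDecay.add {g h : Pt d → ℂ} (hg : RapidDecay g) (hh : RapidDecay h) :
    RapidDecay fun v => g v + h v where
  meas := hg.meas.add hh.meas
  bound M := by
    obtain ⟨C, hC⟩ := hg.bound M
    obtain ⟨D, hD⟩ := hh.bound M
    refine ⟨C + D, fun v => ?_⟩
    calc ‖g v + h v‖ * (1 + ‖v‖) ^ M ≤ (‖g v‖ + ‖h v‖) * (1 + ‖v‖) ^ M := by
          gcongr
          exact norm_add_le _ _
      _ ≤ C + D := by
          rw [add_mul]
          exact add_le_add (hC v) (hD v)

theorem RapidDecay.sum {ι : Type*} (s : Finset ι) {g : ι → Pt d → ℂ}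
    (hg : ∀ i ∈ s, RapidDecay (g i)) : RapidDecay fun v => ∑ i ∈ s, g i v := by
  classical
  induction s using Finset.induction_on with
  | empty =>
    simp only [Finset.sum_empty]
    exact ⟨MeasureTheory.aestronglyMeasurable_const, fun M => ⟨0, fun v => by simp⟩⟩
  | insert a s ha ih =>
    simp only [Finset.sum_insert ha]
    exact (hg a (Finset.mem_insert_self a s)).add
      (ih fun i hi => hg i (Finset.mem_insert_of_mem hi))

theorem PolyGrowth.mul_rapidDecay {p h : Pt d → ℂ} (hp : PolyGrowth p) (hh : RapidDecay h) :
    RapidDecay fun v => p v * h v where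
  meas := hp.cont.aestronglyMeasurable.mul hh.meas
  bound M := by
    obtain ⟨K, C, hC⟩ := hp.bound
    obtain ⟨D, hD⟩ := hh.bound (K + M)
    have hC0 : 0 ≤ C := by
      have := (norm_nonneg _).trans (hC 0)
      simpa using this
    refine ⟨C * D, fun v => ?_⟩
    calc ‖p v * h v‖ * (1 + ‖v‖) ^ M ≤ (C * (1 + ‖v‖) ^ K) * ‖h v‖ * (1 + ‖v‖) ^ M := by
          rw [norm_mul]
          gcongr
          exact hC v
      _ = C * (‖h v‖ * (1 + ‖v‖) ^ (K + M)) := by ring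
      _ ≤ C * D := by
          gcongr
          exact hD v

theorem PolyGrowth.mul {p q : Pt d → ℂ} (hp : PolyGrowth p) (hq : PolyGrowth q) :
    PolyGrowth fun v => p v * q v where
  cont := hp.cont.mul hq.cont
  bound := by
    obtain ⟨K, C, hC⟩ := hp.bound
    obtain ⟨L, D, hD⟩ := hq.bound
    refine ⟨K + L, C * D, fun v => ?_⟩
    calc ‖p v * q v‖ ≤ (C * (1 + ‖v‖) ^ K) * (D * (1 + ‖v‖) ^ L) := by
          rw [norm_mul]
          exact mul_le_mul (hC v) (hD v) (norm_nonneg _) ((norm_nonneg _).trans (hC v))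
      _ = _ := by ring

theorem PolyGrowth.const (c : ℂ) : PolyGrowth fun _ : Pt d => c :=
  ⟨continuous_const, 0, ‖c‖, fun v => by simp⟩

theorem PolyGrowth.pow {p : Pt d → ℂ} (hp : PolyGrowth p) (m : ℕ) :
    PolyGrowth fun v => p v ^ m := by
  induction m with
  | zero => simpa using PolyGrowth.const 1
  | succ m ih =>
    simp only [pow_succ]
    exact ih.mul hp

theorem RapidDecay.integrable_mul {f h : Pt d → ℂ}
    (hf : MeasureTheory.MemLp f 2 MeasureTheory.volume) (hh : RapidDecay h) :
    MeasureTheory.Integrable (fun v => f v * h v) MeasureTheory.volume := by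
  have h2 : MeasureTheory.MemLp h 2 MeasureTheory.volume := by
    rw [MeasureTheory.memLp_two_iff_integrable_sq_norm hh.meas]
    -- One more than the dimension, so that `(1 + ‖v‖)^(-N)` is integrable; one factor of `h`
    -- supplies this decay, the other is merely bounded.
    set N : ℕ := Module.finrank ℝ (Pt d) + 1
    obtain ⟨C, hC⟩ := hh.bound N
    obtain ⟨D, hD⟩ := hh.bound 0
    have h₁ : (MeasureTheory.volume : MeasureTheory.Measure ((Fin d → ℝ) × ℝ)).IsAddHaarMeasure :=
      MeasureTheory.Measure.prod.instIsAddHaarMeasure MeasureTheory.volume MeasureTheory.volume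
    have h₂ : (MeasureTheory.volume : MeasureTheory.Measure (Pt d)).IsAddHaarMeasure :=
      MeasureTheory.Measure.prod.instIsAddHaarMeasure MeasureTheory.volume MeasureTheory.volume
    have hi : MeasureTheory.Integrable (fun v : Pt d => (1 + ‖v‖) ^ (-(N : ℝ)))
        MeasureTheory.volume := integrable_one_add_norm (by simp [N])
    refine (hi.const_mul (D * C)).mono' (hh.meas.norm.pow 2) (Filter.Eventually.of_forall fun v => ?_)
    have h1 : ‖h v‖ ≤ D := by simpa using hD v
    have hpos : (0 : ℝ) < (1 + ‖v‖) ^ N := by positivity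
    have h3 : ‖h v‖ ≤ C * (1 + ‖v‖) ^ (-(N : ℝ)) := by
      rw [Real.rpow_neg (by positivity), Real.rpow_natCast, ← div_eq_mul_inv, le_div_iff₀ hpos]
      exact hC v
    rw [Real.norm_of_nonneg (by positivity), pow_two, mul_assoc]
    exact mul_le_mul h1 h3 (norm_nonneg _) ((norm_nonneg _).trans h1)
  exact h2.integrable_mul hf |>.congr (Filter.Eventually.of_forall fun v => mul_comm _ _)

theorem continuous_zNormSq : Continuous (zNormSq (d := d)) := by
  unfold zNormSq
  fun_prop

theorem continuous_coordNormSq (i : Fin d) : Continuous (coordNormSq i) := by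
  unfold coordNormSq
  fun_prop

theorem zNormSq_nonneg (v : Pt d) : 0 ≤ zNormSq v :=
  Finset.sum_nonneg fun _ _ => by positivity

theorem coordNormSq_le (i : Fin d) (v : Pt d) : coordNormSq i v ≤ 2 * (1 + ‖v‖) ^ 2 := by
  have h1 : |v.1 i| ≤ ‖v‖ := (norm_le_pi_norm v.1 i).trans (norm_fst_le v)
  have h2 : |v.2.1 i| ≤ ‖v‖ :=
    (norm_le_pi_norm v.2.1 i).trans ((norm_fst_le v.2).trans (norm_snd_le v))
  have h3 := sq_le_sq' (by linarith [abs_nonneg (v.1 i), norm_nonneg v]) h1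
  have h4 := sq_le_sq' (by linarith [abs_nonneg (v.2.1 i), norm_nonneg v]) h2
  rw [sq_abs] at h3 h4
  rw [coordNormSq]
  nlinarith [norm_nonneg v]

theorem polyGrowth_coordNormSq (i : Fin d) : PolyGrowth fun v => (coordNormSq i v : ℂ) where
  cont := Complex.continuous_ofReal.comp (continuous_coordNormSq i)
  bound := ⟨2, 2, fun v => by
    rw [Complex.norm_real, Real.norm_of_nonneg (by unfold coordNormSq; positivity)]
    exact coordNormSq_le i v⟩

theorem polyGrowth_zNormSq : PolyGrowth fun v : Pt d => (zNormSq v : ℂ) where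
  cont := Complex.continuous_ofReal.comp continuous_zNormSq
  bound := ⟨2, d * 2, fun v => by
    rw [Complex.norm_real, Real.norm_of_nonneg (zNormSq_nonneg v)]
    refine (Finset.sum_le_sum fun i _ => coordNormSq_le i v).trans (le_of_eq ?_)
    simp
    ring⟩

theorem norm_ofReal_add_mul_I_eq {a b a' : ℝ} (h : a ^ 2 = a' ^ 2) :
    ‖Complex.I * (b : ℂ) - (a : ℂ)‖ = ‖Complex.I * (b : ℂ) - (a' : ℂ)‖ := by
  rw [← sq_eq_sq₀ (norm_nonneg _) (norm_nonneg _), Complex.sq_norm, Complex.sq_norm,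
    Complex.normSq_apply, Complex.normSq_apply]
  simp
  linarith

/-- The real part of `posPoly v` controls `|z|²` and the imaginary part is `s`. Hence decay in
`|posPoly v|` is decay in `v`. -/
theorem one_add_norm_le (v : Pt d) : 1 + ‖v‖ ≤ 4 * (1 + ‖posPoly v‖) := by
  have hre : zNormSq v / 4 ≤ ‖posPoly v‖ := by
    have := Complex.abs_re_le_norm (posPoly v)
    rw [posPoly] at this ⊢
    simp at this
    rw [abs_of_nonneg (by linarith [zNormSq_nonneg v])] at this
    simpa using this
  have him : |v.2.2| ≤ ‖posPoly v‖ := by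
    have := Complex.abs_im_le_norm (posPoly v)
    rw [posPoly] at this ⊢
    simpa using this
  have hz : ∀ i, v.1 i ^ 2 + v.2.1 i ^ 2 ≤ zNormSq v := fun i =>
    Finset.single_le_sum (f := fun i => v.1 i ^ 2 + v.2.1 i ^ 2) (fun _ _ => by positivity)
      (Finset.mem_univ i)
  have h1 : ‖v.1‖ ≤ 1 + 4 * ‖posPoly v‖ := by
    refine (pi_norm_le_iff_of_nonneg (by positivity)).2 fun i => ?_
    rw [Real.norm_eq_abs, abs_le]
    constructor <;> nlinarith [hz i, sq_nonneg (v.2.1 i), sq_nonneg (v.1 i - 1), sq_nonneg (v.1 i + 1)]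
  have h2 : ‖v.2.1‖ ≤ 1 + 4 * ‖posPoly v‖ := by
    refine (pi_norm_le_iff_of_nonneg (by positivity)).2 fun i => ?_
    rw [Real.norm_eq_abs, abs_le]
    constructor <;>
      nlinarith [hz i, sq_nonneg (v.1 i), sq_nonneg (v.2.1 i - 1), sq_nonneg (v.2.1 i + 1)]
  have h3 : ‖v‖ ≤ 1 + 4 * ‖posPoly v‖ := by
    rw [Prod.norm_def, Prod.norm_def]
    refine max_le h1 (max_le h2 ?_)
    rw [Real.norm_eq_abs]
    linarith [norm_nonneg (posPoly v)]
  linarith [norm_nonneg (posPoly v)]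

theorem continuous_posPoly : Continuous (posPoly (d := d)) := by
  have := continuous_zNormSq (d := d)
  unfold posPoly
  fun_prop

theorem polyGrowth_posPoly : PolyGrowth (posPoly (d := d)) where
  cont := continuous_posPoly
  bound := by
    obtain ⟨K, C, hC⟩ := (polyGrowth_zNormSq (d := d)).bound
    refine ⟨K + 1, 1 + C, fun v => ?_⟩
    have hC0 : 0 ≤ C := by simpa using (norm_nonneg _).trans (hC 0)
    have h1 : ‖posPoly v‖ ≤ |v.2.2| + ‖(zNormSq v : ℂ)‖ := by
      refine (norm_sub_le _ _).trans ?_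
      rw [norm_mul, Complex.norm_I, one_mul, Complex.norm_real, Complex.norm_real, Complex.norm_real,
        Real.norm_eq_abs, norm_div]
      have : ‖zNormSq v‖ / ‖(4 : ℝ)‖ ≤ ‖zNormSq v‖ := by
        rw [Real.norm_of_nonneg (by norm_num : (0 : ℝ) ≤ 4)]
        linarith [norm_nonneg (zNormSq v)]
      linarith
    have h2 : |v.2.2| ≤ (1 + ‖v‖) ^ (K + 1) := by
      have h3 : |v.2.2| ≤ ‖v‖ := (norm_snd_le v.2).trans (norm_snd_le v)
      have h4 : (1 + ‖v‖) ≤ (1 + ‖v‖) ^ (K + 1) :=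
        le_self_pow₀ (by linarith [norm_nonneg v]) (by omega)
      linarith
    have h3 : C * (1 + ‖v‖) ^ K ≤ C * (1 + ‖v‖) ^ (K + 1) := by
      gcongr
      · linarith [norm_nonneg v]
      · omega
    linarith [hC v]

/-! ### Oscillatory kernels -/

/-- The kernel `exp(i λ s - |λ| |z|² / 4)`. -/
def gaussKernel (lam : ℝ) (v : Pt d) : ℂ :=
  Complex.exp (Complex.I * (lam * v.2.2 : ℝ)) * (Real.exp (-(|lam| * zNormSq v) / 4) : ℝ)

theorem gaussKernel_eq_exp {ε lam : ℝ} (h : |lam| = ε * lam) (v : Pt d) :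
    gaussKernel lam v
      = Complex.exp ((Complex.I * (v.2.2 : ℂ) - ((ε * zNormSq v / 4 : ℝ) : ℂ)) * lam) := by
  rw [gaussKernel, Complex.ofReal_exp, ← Complex.exp_add, h]
  congr 1
  push_cast
  ring

theorem norm_gaussKernel_le (lam : ℝ) (v : Pt d) : ‖gaussKernel lam v‖ ≤ 1 := by
  rw [gaussKernel, norm_mul, mul_comm Complex.I, Complex.norm_exp_ofReal_mul_I, one_mul,
    Complex.norm_real, Real.norm_of_nonneg (Real.exp_pos _).le, Real.exp_le_one_iff]
  have := mul_nonneg (abs_nonneg lam) (zNormSq_nonneg v)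
  linarith

theorem continuous_gaussKernel : Continuous (Function.uncurry (gaussKernel (d := d))) := by
  have := continuous_zNormSq (d := d)
  unfold gaussKernel Function.uncurry
  fun_prop

/-- On the half-line `ελ > 0` the kernel is `exp(κλ)` with `κ = i s - ε|z|²/4` and `|κ| = |posPoly
v|`. Each integration by parts in `λ` trades one factor `κ` for a derivative of `ψ`. -/
theorem bound_integral_gaussKernel_of_sign {ε : ℝ} (hε : ε ^ 2 = 1) (M : ℕ) {ψ : ℝ → ℂ}
    (hψ : IsFreqTest ψ) (hs : ∀ lam, ε * lam ≤ 0 → ψ lam = 0) :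
    ∃ C : ℝ, ∀ v : Pt d, ‖posPoly v‖ ^ M * ‖∫ lam, ψ lam * gaussKernel lam v‖ ≤ C := by
  induction M generalizing ψ with
  | zero =>
    refine ⟨∫ lam, ‖ψ lam‖, fun v => ?_⟩
    rw [pow_zero, one_mul]
    refine MeasureTheory.norm_integral_le_of_norm_le
      (hψ.smooth.continuous.integrable_of_hasCompactSupport hψ.compact).norm
      (Filter.Eventually.of_forall fun lam => ?_)
    rw [norm_mul]
    exact mul_le_of_le_one_right (norm_nonneg _) (norm_gaussKernel_le lam v)
  | succ M ih =>
    have hs' : ∀ lam, ε * lam ≤ 0 → deriv ψ lam = 0 := by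
      intro lam hl
      rcases hl.lt_or_eq with h | h
      · have h1 : ψ =ᶠ[nhds lam] fun _ => 0 := by
          have h2 : ∀ᶠ y in nhds lam, ε * y < 0 :=
            (continuous_const.mul continuous_id).continuousAt.eventually_lt continuousAt_const h
          filter_upwards [h2] with y hy
          exact hs y hy.le
        rw [h1.deriv_eq, deriv_const]
      · have hε0 : ε ≠ 0 := by
          rintro rfl
          norm_num at hε
        rw [(mul_eq_zero.1 h).resolve_left hε0]
        exact hψ.deriv.apply_zero
    obtain ⟨C, hC⟩ := ih hψ.deriv hs'
    refine ⟨C, fun v => ?_⟩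
    set κ : ℂ := Complex.I * (v.2.2 : ℂ) - ((ε * zNormSq v / 4 : ℝ) : ℂ)
    have hκ : ‖posPoly v‖ = ‖κ‖ := by
      refine norm_ofReal_add_mul_I_eq ?_
      rw [div_pow, div_pow, mul_pow, hε, one_mul]
    have habs : ∀ lam, ¬ ε * lam ≤ 0 → |lam| = ε * lam := by
      intro lam hl
      have h1 : |ε| = 1 := by
        rw [← sq_eq_sq₀ (abs_nonneg _) zero_le_one, sq_abs, hε, one_pow]
      rw [← abs_of_pos (not_le.1 hl), abs_mul, h1, one_mul]
    have hrep : ∀ {χ : ℝ → ℂ}, (∀ lam, ε * lam ≤ 0 → χ lam = 0) →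
        (fun lam => χ lam * gaussKernel lam v) = fun lam => χ lam * Complex.exp (κ * lam) := by
      intro χ hχ
      funext lam
      by_cases hl : ε * lam ≤ 0
      · rw [hχ lam hl, zero_mul, zero_mul]
      · rw [gaussKernel_eq_exp (habs lam hl)]
    have hder : ∀ lam : ℝ, HasDerivAt (fun lam : ℝ => Complex.exp (κ * lam))
        (κ * Complex.exp (κ * lam)) lam := by
      intro lam
      have h1 : HasDerivAt (fun z : ℂ => Complex.exp (κ * z)) (Complex.exp (κ * lam) * (κ * 1)) lam :=
        ((hasDerivAt_id _).const_mul κ).cexp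
      rw [mul_one, mul_comm] at h1
      exact h1.comp_ofReal
    have hibp := hψ.integral_mul_deriv (fun lam _ => hder lam)
      (Continuous.continuousOn (by fun_prop))
    have h3 : ∫ lam, ψ lam * (κ * Complex.exp (κ * lam)) = κ * ∫ lam, ψ lam * Complex.exp (κ * lam) := by
      rw [← MeasureTheory.integral_const_mul]
      congr 1
      funext lam
      ring
    have := hC v
    rw [hrep hs'] at this
    rw [hrep hs, pow_succ, mul_assoc]
    conv_lhs => rw [hκ, ← norm_mul, ← h3, hibp, norm_neg, ← hκ]
    exact this

theorem bound_integral_gaussKernel (M : ℕ) {ψ : ℝ → ℂ} (hψ : IsFreqTest ψ) :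
    ∃ C : ℝ, ∀ v : Pt d, ‖posPoly v‖ ^ M * ‖∫ lam, ψ lam * gaussKernel lam v‖ ≤ C := by
  -- Cutting `ψ` at 0 keeps both halves smooth, since `ψ` vanishes near 0.
  have h1 := hψ.mul (contDiffOn_ite_pos (contDiffOn_const (c := 1)) (contDiffOn_const (c := 0)))
  have h2 := hψ.mul (contDiffOn_ite_pos (contDiffOn_const (c := 0)) (contDiffOn_const (c := 1)))
  obtain ⟨C, hC⟩ := bound_integral_gaussKernel_of_sign (d := d) (ε := 1) (by norm_num) M h1
    fun lam hl => by rw [if_neg (by linarith), zero_mul]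
  obtain ⟨D, hD⟩ := bound_integral_gaussKernel_of_sign (d := d) (ε := -1) (by norm_num) M h2
    fun lam hl => by
      rcases eq_or_ne lam 0 with rfl | h
      · rw [hψ.apply_zero, mul_zero]
      · rw [if_pos (lt_of_le_of_ne (by linarith) h.symm), zero_mul]
  refine ⟨C + D, fun v => ?_⟩
  have hG : ContinuousOn (fun lam => gaussKernel lam v) {0}ᶜ :=
    (continuous_gaussKernel.comp (continuous_id.prodMk continuous_const)).continuousOn
  have hsum : ∫ lam, ψ lam * gaussKernel lam v
      = (∫ lam, (if 0 < lam then (1 : ℂ) else 0) * ψ lam * gaussKernel lam v)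
        + ∫ lam, (if 0 < lam then (0 : ℂ) else 1) * ψ lam * gaussKernel lam v := by
    rw [← MeasureTheory.integral_add (h1.integrable_mul hG) (h2.integrable_mul hG)]
    congr 1
    funext lam
    split_ifs <;> ring
  calc ‖posPoly v‖ ^ M * ‖∫ lam, ψ lam * gaussKernel lam v‖
      ≤ ‖posPoly v‖ ^ M * (‖∫ lam, (if 0 < lam then (1 : ℂ) else 0) * ψ lam * gaussKernel lam v‖
        + ‖∫ lam, (if 0 < lam then (0 : ℂ) else 1) * ψ lam * gaussKernel lam v‖) := by
        rw [hsum]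
        gcongr
        exact norm_add_le _ _
    _ ≤ C + D := by
        rw [mul_add]
        exact add_le_add (hC v) (hD v)

/-- Continuous kernels `G λ v` whose averages against test functions of `λ` decay rapidly in `v`. -/
structure RapidKernel (G : ℝ → Pt d → ℂ) : Prop where
  cont : Continuous (Function.uncurry G)
  decay : ∀ ψ : ℝ → ℂ, IsFreqTest ψ → RapidDecay fun v => ∫ lam, ψ lam * G lam v

theorem RapidKernel.continuousOn {G : ℝ → Pt d → ℂ} (hG : RapidKernel G) (v : Pt d) :
    ContinuousOn (fun lam => G lam v) {0}ᶜ :=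
  (hG.cont.comp (continuous_id.prodMk continuous_const)).continuousOn

theorem rapidKernel_gaussKernel : RapidKernel (gaussKernel (d := d)) where
  cont := continuous_gaussKernel
  decay ψ hψ :=
    { meas := by
        have h : Continuous fun p : Pt d × ℝ => ψ p.2 * gaussKernel p.2 p.1 :=
          (hψ.smooth.continuous.comp continuous_snd).mul
            (continuous_gaussKernel.comp (continuous_snd.prodMk continuous_fst))
        exact h.stronglyMeasurable.integral_prod_right'.aestronglyMeasurable
      bound := fun M => by
        obtain ⟨C, hC⟩ := bound_integral_gaussKernel (d := d) 0 hψ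
        obtain ⟨D, hD⟩ := bound_integral_gaussKernel (d := d) M hψ
        refine ⟨4 ^ M * 2 ^ (M - 1) * (C + D), fun v => ?_⟩
        have h1 : (1 + ‖v‖) ^ M ≤ 4 ^ M * (2 ^ (M - 1) * (1 ^ M + ‖posPoly v‖ ^ M)) := by
          refine (pow_le_pow_left₀ (by positivity) (one_add_norm_le v) M).trans ?_
          rw [mul_pow]
          gcongr
          exact add_pow_le zero_le_one (norm_nonneg _) M
        calc ‖∫ lam, ψ lam * gaussKernel lam v‖ * (1 + ‖v‖) ^ M
            ≤ ‖∫ lam, ψ lam * gaussKernel lam v‖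
              * (4 ^ M * (2 ^ (M - 1) * (1 ^ M + ‖posPoly v‖ ^ M))) := by gcongr
          _ = 4 ^ M * 2 ^ (M - 1) * (‖posPoly v‖ ^ 0 * ‖∫ lam, ψ lam * gaussKernel lam v‖
              + ‖posPoly v‖ ^ M * ‖∫ lam, ψ lam * gaussKernel lam v‖) := by
              rw [one_pow, pow_zero]
              ring
          _ ≤ _ := by
              gcongr
              · exact hC v
              · exact hD v }

theorem RapidKernel.sum {ι : Type*} (s : Finset ι) {G : ι → ℝ → Pt d → ℂ}
    (hG : ∀ i ∈ s, RapidKernel (G i)) : RapidKernel fun lam v => ∑ i ∈ s, G i lam v where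
  cont := continuous_finsetSum s fun i hi => (hG i hi).cont
  decay ψ hψ := by
    have h : (fun v => ∫ lam, ψ lam * ∑ i ∈ s, G i lam v)
        = fun v => ∑ i ∈ s, ∫ lam, ψ lam * G i lam v := by
      funext v
      rw [← MeasureTheory.integral_finsetSum s fun i hi => hψ.integrable_mul ((hG i hi).continuousOn v)]
      simp only [Finset.mul_sum]
    rw [h]
    exact RapidDecay.sum s fun i hi => (hG i hi).decay ψ hψ

/-- Powers of `|λ|` pass into the test function and polynomial growth in `v` is absorbed by the
decay; Laguerre factors are sums of such products. -/
theorem RapidKernel.abs_pow_mul {G : ℝ → Pt d → ℂ} (hG : RapidKernel G) (i : ℕ) {p : Pt d → ℂ}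
    (hp : PolyGrowth p) : RapidKernel fun lam v => ((|lam| ^ i : ℝ) : ℂ) * p v * G lam v where
  cont := by
    have h1 := hG.cont
    have h2 := hp.cont
    unfold Function.uncurry at h1 ⊢
    fun_prop
  decay ψ hψ := by
    have h : (fun v => ∫ lam, ψ lam * (((|lam| ^ i : ℝ) : ℂ) * p v * G lam v))
        = fun v => p v * ∫ lam, ((|lam| ^ i : ℝ) : ℂ) * ψ lam * G lam v := by
      funext v
      rw [← MeasureTheory.integral_const_mul]
      congr 1
      funext lam
      ring
    rw [h]
    exact hp.mul_rapidDecay (hG.decay _ (hψ.mul (contDiffOn_abs_pow i)))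

theorem RapidKernel.laguerre_mul {G : ℝ → Pt d → ℂ} (hG : RapidKernel G) (a n : ℕ) {ρ : Pt d → ℝ}
    (hρ : PolyGrowth fun v => (ρ v : ℂ)) :
    RapidKernel fun lam v => (laguerre a n (|lam| * ρ v / 2) : ℂ) * G lam v := by
  have h : (fun lam v => (laguerre a n (|lam| * ρ v / 2) : ℂ) * G lam v)
      = fun lam v => ∑ i ∈ Finset.range (n + 1), ((|lam| ^ i : ℝ) : ℂ)
        * ((((-1) ^ i * ((n + a).choose (n - i) : ℝ) / (i.factorial : ℝ) / 2 ^ i : ℝ) : ℂ)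
          * (ρ v : ℂ) ^ i) * G lam v := by
    funext lam v
    rw [laguerre, Complex.ofReal_sum, Finset.sum_mul]
    refine Finset.sum_congr rfl fun i _ => ?_
    rw [div_pow, mul_pow]
    push_cast
    ring
  rw [h]
  exact RapidKernel.sum _ fun i _ => hG.abs_pow_mul i ((PolyGrowth.const _).mul (hρ.pow i))

theorem RapidKernel.prod_laguerre_mul {G : ℝ → Pt d → ℂ} (hG : RapidKernel G) (k : Fin d → ℕ)
    (s : Finset (Fin d)) :
    RapidKernel fun lam v =>
      (∏ i ∈ s, (laguerre 0 (k i) (|lam| * coordNormSq i v / 2) : ℂ)) * G lam v := by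
  classical
  induction s using Finset.induction_on with
  | empty => simpa using hG
  | insert a s ha ih =>
    simp only [Finset.prod_insert ha, mul_assoc]
    exact ih.laguerre_mul 0 (k a) (polyGrowth_coordNormSq a)

theorem rapidKernel_conj_ell (n : ℕ) :
    RapidKernel fun lam (v : Pt d) => starRingEnd ℂ (ell n lam v) := by
  have h := (rapidKernel_gaussKernel (d := d)).laguerre_mul (d - 1) n polyGrowth_zNormSq
  have h2 := h.abs_pow_mul 0 (PolyGrowth.const ((((d - 1 + n).choose n : ℝ)⁻¹ : ℝ) : ℂ))
  convert h2 using 3 with lam v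
  rw [conj_ell, gaussKernel, pow_zero]
  push_cast
  ring

theorem rapidDecay_integral_matrixCoeff (k : Fin d → ℕ) {ψ : ℝ → ℂ} (hψ : IsFreqTest ψ) :
    RapidDecay fun v => ∫ lam, ψ lam * matrixCoeff k k lam v := by
  have h := ((rapidKernel_gaussKernel (d := d)).prod_laguerre_mul k Finset.univ).decay ψ hψ
  convert h using 3 with v
  funext lam
  rcases eq_or_ne lam 0 with rfl | hl
  · rw [hψ.apply_zero, zero_mul, zero_mul]
  · rw [matrixCoeff_self _ hl, gaussKernel]
    push_cast
    ring

theorem integrable_mul_integral_matrixCoeff {f : Pt d → ℂ}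
    (hf : MeasureTheory.MemLp f 2 MeasureTheory.volume) (k : Fin d → ℕ) {ψ : ℝ → ℂ}
    (hψ : IsFreqTest ψ) :
    MeasureTheory.Integrable (fun v => f v * ∫ lam, ψ lam * matrixCoeff k k lam v)
      MeasureTheory.volume :=
  RapidDecay.integrable_mul hf (rapidDecay_integral_matrixCoeff k hψ)

theorem integrable_posPoly_pow_mul {f : Pt d → ℂ}
    (hf : MeasureTheory.MemLp f 2 MeasureTheory.volume) (m n : ℕ) {ψ : ℝ → ℂ}
    (hψ : IsFreqTest ψ) :
    MeasureTheory.Integrable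
      (fun v => posPoly v ^ m * f v * ∫ lam, ψ lam * starRingEnd ℂ (ell n lam v))
      MeasureTheory.volume := by
  refine (RapidDecay.integrable_mul hf ((polyGrowth_posPoly.pow m).mul_rapidDecay
    ((rapidKernel_conj_ell n).decay ψ hψ))).congr (Filter.Eventually.of_forall fun v => ?_)
  simp only
  ring

end Kernels

/-! ### Multiplication by `i s - |z|² / 4` on the frequency side -/

theorem hasDerivAt_laguerre (a n : ℕ) (t : ℝ) :
    HasDerivAt (laguerre a n) (laguerre a n t - laguerre (a + 1) n t) t := by
  cases n with
  | zero =>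
    rw [laguerre_zero_left, laguerre_zero_left, sub_self]
    have : laguerre a 0 = fun _ => 1 := funext (laguerre_zero_left a)
    rw [this]
    exact hasDerivAt_const t 1
  | succ n =>
    have h := hasDerivAt_laguerre_succ a n t
    rwa [show -laguerre (a + 1) n t = laguerre a (n + 1) t - laguerre (a + 1) (n + 1) t by
      rw [laguerre_pascal]; ring] at h

/-- The coefficient of the forward difference in `n`, present for negative frequencies. -/
def forwardCoeff (d n : ℕ) (lam : ℝ) : ℂ := if 0 < lam then 0 else (((n : ℝ) + d) / lam : ℝ)

/-- The coefficient of the backward difference in `n`, present for positive frequencies. -/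
def backwardCoeff (n : ℕ) (lam : ℝ) : ℂ := if 0 < lam then ((n : ℝ) / lam : ℝ) else 0

theorem contDiffOn_ofReal_div (c : ℝ) : ContDiffOn ℝ ∞ (fun lam : ℝ => ((c / lam : ℝ) : ℂ)) {0}ᶜ := by
  intro x hx
  exact (Complex.ofRealCLM.contDiff.contDiffAt.comp x
    (contDiffAt_const.div contDiffAt_id hx)).contDiffWithinAt

theorem contDiffOn_forwardCoeff (d n : ℕ) : ContDiffOn ℝ ∞ (forwardCoeff d n) {0}ᶜ :=
  contDiffOn_ite_pos contDiffOn_const (contDiffOn_ofReal_div _)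

theorem contDiffOn_backwardCoeff (n : ℕ) : ContDiffOn ℝ ∞ (backwardCoeff n) {0}ᶜ :=
  contDiffOn_ite_pos (contDiffOn_ofReal_div _) contDiffOn_const

theorem conj_ell_eq_gaussKernel {d : ℕ} (n : ℕ) (lam : ℝ) (v : Pt d) :
    starRingEnd ℂ (ell n lam v) = ((((d - 1 + n).choose n : ℝ)⁻¹ : ℝ) : ℂ)
      * (gaussKernel lam v * (laguerre (d - 1) n (|lam| * zNormSq v / 2) : ℂ)) := by
  rw [conj_ell, gaussKernel, Complex.ofReal_mul (Real.exp _), mul_assoc (Complex.exp _)]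

/-- This ratio of normalisations makes the two terms of `mul_laguerre_succ_left` a genuine
difference of consecutive `ℓ_n^λ`. -/
theorem inv_choose_succ (a n : ℕ) :
    (((a + (n + 1)).choose (n + 1) : ℝ)⁻¹) * ((n : ℝ) + 1 + a)
      = ((n : ℝ) + 1) * (((a + n).choose n : ℝ)⁻¹) := by
  have h1 : ((a + (n + 1)).choose (n + 1) : ℝ) ≠ 0 := by
    exact_mod_cast (Nat.choose_pos (Nat.le_add_left _ _)).ne'
  have h2 : ((a + n).choose n : ℝ) ≠ 0 := by
    exact_mod_cast (Nat.choose_pos (Nat.le_add_left _ _)).ne'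
  have h3 : ((a + n : ℝ) + 1) * ((a + n).choose n : ℝ)
      = ((a + (n + 1)).choose (n + 1) : ℝ) * ((n : ℝ) + 1) := by
    exact_mod_cast Nat.add_one_mul_choose_eq (a + n) n
  field_simp
  linear_combination h3

/-- On `ελ > 0` differentiate `exp(κλ)` times a Laguerre polynomial. For `ε = 1` the remainder is a
multiple of `|z|² L_{n-1}^d`. For `ε = -1` the excess `κ - posPoly v = |z|²/2` cancels the
`L_n^{d-1}` term and leaves a multiple of `|z|² L_n^d`. `mul_laguerre_succ_left` turns these into
backward and forward differences. -/
theorem hasDerivAt_conj_ell {d : ℕ} (hd : 1 ≤ d) (n : ℕ) {lam : ℝ} (hl : lam ≠ 0) (v : Pt d) :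
    HasDerivAt (fun lam => starRingEnd ℂ (ell n lam v))
      (posPoly v * starRingEnd ℂ (ell n lam v)
        + forwardCoeff d n lam
          * (starRingEnd ℂ (ell (n + 1) lam v) - starRingEnd ℂ (ell n lam v))
        + backwardCoeff n lam
          * (starRingEnd ℂ (ell n lam v) - starRingEnd ℂ (ell (n - 1) lam v))) lam := by
  obtain ⟨a, rfl⟩ := Nat.exists_eq_add_of_le' hd
  have hb : ∀ n : ℕ, ((((a + (n + 1)).choose (n + 1) : ℝ)⁻¹ : ℝ) : ℂ) * ((n : ℂ) + 1 + a)
      = ((n : ℂ) + 1) * ((((a + n).choose n : ℝ)⁻¹ : ℝ) : ℂ) := fun n => by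
    exact_mod_cast congrArg Complex.ofReal (inv_choose_succ a n)
  have hgen : ∀ ε : ℝ, (∀ᶠ x in nhds lam, |x| = ε * x) →
      HasDerivAt (fun lam => starRingEnd ℂ (ell n lam v))
        ((Complex.I * (v.2.2 : ℂ) - ((ε * zNormSq v / 4 : ℝ) : ℂ)) * starRingEnd ℂ (ell n lam v)
          + ((((a + n).choose n : ℝ)⁻¹ : ℝ) : ℂ) * (gaussKernel lam v * (ε * zNormSq v / 2 : ℝ)
            * ((laguerre a n (|lam| * zNormSq v / 2)
              - laguerre (a + 1) n (|lam| * zNormSq v / 2) : ℝ) : ℂ))) lam := by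
    intro ε hε
    set κ : ℂ := Complex.I * (v.2.2 : ℂ) - ((ε * zNormSq v / 4 : ℝ) : ℂ)
    have h1 : HasDerivAt (fun x : ℝ => Complex.exp (κ * x)) (κ * Complex.exp (κ * lam)) lam := by
      have h1 : HasDerivAt (fun z : ℂ => Complex.exp (κ * z)) (Complex.exp (κ * lam) * (κ * 1)) lam :=
        ((hasDerivAt_id _).const_mul κ).cexp
      rw [mul_one, mul_comm] at h1
      exact h1.comp_ofReal
    have h2 : HasDerivAt (fun x : ℝ => ((laguerre a n ((ε * x) * zNormSq v / 2) : ℝ) : ℂ))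
        (((laguerre a n ((ε * lam) * zNormSq v / 2)
          - laguerre (a + 1) n ((ε * lam) * zNormSq v / 2)) * (ε * zNormSq v / 2) : ℝ) : ℂ) lam := by
      have h3 : HasDerivAt (fun x : ℝ => (ε * x) * zNormSq v / 2) (ε * zNormSq v / 2) lam := by
        have := (((hasDerivAt_id lam).const_mul ε).mul_const (zNormSq v)).div_const 2
        simpa using this
      exact ((hasDerivAt_laguerre a n _).comp lam h3).ofReal_comp
    have h4 := (h1.mul h2).const_mul ((((a + n).choose n : ℝ)⁻¹ : ℝ) : ℂ)
    have hself := hε.self_of_nhds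
    refine (h4.congr_of_eventuallyEq ?_).congr_deriv ?_
    · filter_upwards [hε] with x hx
      rw [conj_ell_eq_gaussKernel, gaussKernel_eq_exp hx, hx]
      rfl
    · have hG : gaussKernel lam v = Complex.exp (κ * lam) := gaussKernel_eq_exp hself v
      rw [conj_ell_eq_gaussKernel, hG, hself]
      simp only [Nat.add_sub_cancel]
      push_cast
      ring
  have hlc : (lam : ℂ) ≠ 0 := by exact_mod_cast hl
  rcases lt_or_gt_of_ne hl with h | h
  · refine (hgen (-1) ?_).congr_deriv ?_
    · filter_upwards [Iio_mem_nhds h] with x hx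
      rw [abs_of_neg hx]
      ring
    · rw [forwardCoeff, backwardCoeff, if_neg h.not_gt, if_neg h.not_gt, conj_ell_eq_gaussKernel n,
        conj_ell_eq_gaussKernel (n + 1), posPoly]
      simp only [Nat.add_sub_cancel]
      have ht := congrArg Complex.ofReal (mul_laguerre_succ_left a n (|lam| * zNormSq v / 2))
      have hb' := hb n
      rw [abs_of_neg h] at ht ⊢
      generalize laguerre (a + 1) n (-lam * zNormSq v / 2) = M at ht ⊢
      generalize laguerre a (n + 1) (-lam * zNormSq v / 2) = L₁ at ht ⊢
      generalize laguerre a n (-lam * zNormSq v / 2) = L at ht ⊢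
      generalize ((a + (n + 1)).choose (n + 1) : ℝ)⁻¹ = b₁ at hb' ⊢
      generalize ((a + n).choose n : ℝ)⁻¹ = b at hb' ⊢
      push_cast at ht hb' ⊢
      linear_combination (-(b * gaussKernel lam v * M * zNormSq v / 2)) * mul_inv_cancel₀ hlc
        - b * gaussKernel lam v * (lam : ℂ)⁻¹ * ht - gaussKernel lam v * (lam : ℂ)⁻¹ * L₁ * hb'
  · refine (hgen 1 ?_).congr_deriv ?_
    · filter_upwards [Ioi_mem_nhds h] with x hx
      rw [abs_of_pos hx, one_mul]
    · rw [forwardCoeff, backwardCoeff, if_pos h, if_pos h, posPoly]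
      rw [zero_mul, add_zero, one_mul]
      congr 1
      cases n with
      -- The backward coefficient is 0 at `n = 0`, so the truncated `n - 1` is harmless.
      | zero => simp [laguerre_zero_left]
      | succ n =>
        rw [conj_ell_eq_gaussKernel (n + 1), conj_ell_eq_gaussKernel (n + 1 - 1), laguerre_pascal]
        simp only [Nat.add_sub_cancel]
        have ht := congrArg Complex.ofReal (mul_laguerre_succ_left a n (|lam| * zNormSq v / 2))
        have hb' := hb n
        rw [abs_of_pos h] at ht ⊢
        generalize laguerre (a + 1) n (lam * zNormSq v / 2) = M at ht ⊢
        generalize laguerre a (n + 1) (lam * zNormSq v / 2) = L₁ at ht ⊢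
        generalize laguerre a n (lam * zNormSq v / 2) = L at ht ⊢
        generalize ((a + (n + 1)).choose (n + 1) : ℝ)⁻¹ = b₁ at hb' ⊢
        generalize ((a + n).choose n : ℝ)⁻¹ = b at hb' ⊢
        push_cast at ht hb' ⊢
        linear_combination (b₁ * gaussKernel lam v * M * zNormSq v / 2) * mul_inv_cancel₀ hlc
          - b₁ * gaussKernel lam v * (lam : ℂ)⁻¹ * ht - gaussKernel lam v * (lam : ℂ)⁻¹ * L * hb'

/-- The biradial transform of `(i s - |z|² / 4)^m φ(-Δ)δ`. -/
def biradial (d : ℕ) (φ : ℝ → ℂ) : ℕ → ℕ → ℝ → ℂ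
  | 0, n, lam => φ (|lam| * ((d : ℝ) + 2 * (n : ℝ)))
  | m + 1, n, lam => deriv (biradial d φ m n) lam
      - forwardCoeff d n lam * (biradial d φ m (n + 1) lam - biradial d φ m n lam)
      - backwardCoeff n lam * (biradial d φ m n lam - biradial d φ m (n - 1) lam)

/-- Each step of the recursion costs one derivative. Since `d ≥ 1`, the argument `|λ|(d + 2n)` stays
in the open half-line. -/
theorem contDiffOn_biradial {d : ℕ} (hd : 1 ≤ d) {φ : ℝ → ℂ} (m k : ℕ)
    (hφ : ContDiffOn ℝ ((m + k : ℕ) : ℕ∞) φ (Set.Ioi 0)) (n : ℕ) :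
    ContDiffOn ℝ ((k : ℕ) : ℕ∞) (biradial d φ m n) {0}ᶜ := by
  induction m generalizing k n with
  | zero =>
    rw [zero_add] at hφ
    refine hφ.comp (t := Set.Ioi 0) (f := fun lam : ℝ => |lam| * ((d : ℝ) + 2 * (n : ℝ)))
      (fun x hx => ((contDiffAt_abs hx).mul contDiffAt_const).contDiffWithinAt) fun x hx => ?_
    have h1 : (0 : ℝ) < d := by exact_mod_cast hd
    have h2 : 0 < |x| := abs_pos.2 hx
    exact Set.mem_Ioi.2 (by positivity)
  | succ m ih =>
    have h0 : ∀ n, ContDiffOn ℝ (((k + 1 : ℕ) : ℕ∞) : WithTop ℕ∞) (biradial d φ m n) {0}ᶜ := fun n =>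
      ih (k + 1) (by rwa [show m + (k + 1) = m + 1 + k by ring]) n
    have h1 : ∀ n, ContDiffOn ℝ ((k : ℕ) : ℕ∞) (biradial d φ m n) {0}ᶜ := fun n =>
      (h0 n).of_le (by exact_mod_cast Nat.le_succ k)
    have h2 : ContDiffOn ℝ ((k : ℕ) : ℕ∞) (deriv (biradial d φ m n)) {0}ᶜ :=
      (h0 n).deriv_of_isOpen isOpen_compl_singleton (by exact_mod_cast le_rfl)
    have hk : (((k : ℕ) : ℕ∞) : WithTop ℕ∞) ≤ ∞ := by exact_mod_cast le_top
    exact (h2.sub (((contDiffOn_forwardCoeff d n).of_le hk).mul ((h1 (n + 1)).sub (h1 n)))).sub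
      (((contDiffOn_backwardCoeff n).of_le hk).mul ((h1 n).sub (h1 (n - 1))))

theorem hasDerivAt_biradial {d : ℕ} (hd : 1 ≤ d) {φ : ℝ → ℂ} (m : ℕ)
    (hφ : ContDiffOn ℝ ((m + 1 : ℕ) : ℕ∞) φ (Set.Ioi 0)) (n : ℕ) {lam : ℝ} (hl : lam ≠ 0) :
    HasDerivAt (biradial d φ m n) (deriv (biradial d φ m n) lam) lam :=
  (((contDiffOn_biradial hd m 1 hφ n).contDiffAt
    (isOpen_compl_singleton.mem_nhds hl)).differentiableAt (by simp)).hasDerivAt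

theorem integral_sub_sub {α : Type*} [MeasurableSpace α] {μ : MeasureTheory.Measure α}
    {g₀ g₁ g₂ g₃ g₄ : α → ℂ} (h₀ : MeasureTheory.Integrable g₀ μ)
    (h₁ : MeasureTheory.Integrable g₁ μ) (h₂ : MeasureTheory.Integrable g₂ μ)
    (h₃ : MeasureTheory.Integrable g₃ μ) (h₄ : MeasureTheory.Integrable g₄ μ) :
    ∫ x, (g₀ x - (g₁ x - g₂ x) - (g₃ x - g₄ x)) ∂μ
      = (∫ x, g₀ x ∂μ) - ((∫ x, g₁ x ∂μ) - ∫ x, g₂ x ∂μ) - ((∫ x, g₃ x ∂μ) - ∫ x, g₄ x ∂μ) := by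
  rw [← MeasureTheory.integral_sub h₁ h₂, ← MeasureTheory.integral_sub h₃ h₄,
    ← MeasureTheory.integral_sub h₀
      (show MeasureTheory.Integrable (fun x => g₁ x - g₂ x) μ from h₁.sub h₂),
    ← MeasureTheory.integral_sub
      (show MeasureTheory.Integrable (fun x => g₀ x - (g₁ x - g₂ x)) μ from h₀.sub (h₁.sub h₂))
      (show MeasureTheory.Integrable (fun x => g₃ x - g₄ x) μ from h₃.sub h₄)]

/-- Applied both to `ℓ_n^λ` and to the candidate transform, it puts the two sides of the duality in
the same form, with all coefficients moved to the test function. -/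
theorem integral_mul_difference (d n : ℕ) {F : ℕ → ℝ → ℂ} {F' : ℝ → ℂ}
    (hF : ∀ k, ContinuousOn (F k) {0}ᶜ) (hF' : ContinuousOn F' {0}ᶜ)
    (hder : ∀ lam, lam ≠ 0 → HasDerivAt (F n) (F' lam) lam) {ψ : ℝ → ℂ} (hψ : IsFreqTest ψ) :
    ∫ lam, ψ lam * (F' lam - forwardCoeff d n lam * (F (n + 1) lam - F n lam)
        - backwardCoeff n lam * (F n lam - F (n - 1) lam))
      = -(∫ lam, deriv ψ lam * F n lam)
        - ((∫ lam, forwardCoeff d n lam * ψ lam * F (n + 1) lam)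
          - ∫ lam, forwardCoeff d n lam * ψ lam * F n lam)
        - ((∫ lam, backwardCoeff n lam * ψ lam * F n lam)
          - ∫ lam, backwardCoeff n lam * ψ lam * F (n - 1) lam) := by
  have hA := hψ.mul (contDiffOn_forwardCoeff d n)
  have hB := hψ.mul (contDiffOn_backwardCoeff n)
  rw [← hψ.integral_mul_deriv hder hF', ← integral_sub_sub (hψ.integrable_mul hF')
    (hA.integrable_mul (hF _)) (hA.integrable_mul (hF _)) (hB.integrable_mul (hF _))
    (hB.integrable_mul (hF _))]
  congr 1
  funext lam
  ring

theorem posPoly_mul_integral_conj_ell {d : ℕ} (hd : 1 ≤ d) (n : ℕ) (v : Pt d) {ψ : ℝ → ℂ}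
    (hψ : IsFreqTest ψ) :
    posPoly v * ∫ lam, ψ lam * starRingEnd ℂ (ell n lam v)
      = -(∫ lam, deriv ψ lam * starRingEnd ℂ (ell n lam v))
        - ((∫ lam, forwardCoeff d n lam * ψ lam * starRingEnd ℂ (ell (n + 1) lam v))
          - ∫ lam, forwardCoeff d n lam * ψ lam * starRingEnd ℂ (ell n lam v))
        - ((∫ lam, backwardCoeff n lam * ψ lam * starRingEnd ℂ (ell n lam v))
          - ∫ lam, backwardCoeff n lam * ψ lam * starRingEnd ℂ (ell (n - 1) lam v)) := by
  have hc : ∀ k, ContinuousOn (fun lam => starRingEnd ℂ (ell k lam v)) {0}ᶜ := fun k =>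
    (rapidKernel_conj_ell k).continuousOn v
  have hF' : ContinuousOn (fun lam => posPoly v * starRingEnd ℂ (ell n lam v)
        + forwardCoeff d n lam
          * (starRingEnd ℂ (ell (n + 1) lam v) - starRingEnd ℂ (ell n lam v))
        + backwardCoeff n lam
          * (starRingEnd ℂ (ell n lam v) - starRingEnd ℂ (ell (n - 1) lam v))) {0}ᶜ :=
    ((continuousOn_const.mul (hc n)).add
      ((contDiffOn_forwardCoeff d n).continuousOn.mul ((hc (n + 1)).sub (hc n)))).add
      ((contDiffOn_backwardCoeff n).continuousOn.mul ((hc n).sub (hc (n - 1))))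
  rw [← integral_mul_difference d n (F := fun k lam => starRingEnd ℂ (ell k lam v)) hc hF'
    (fun lam hl => hasDerivAt_conj_ell hd n hl v) hψ, ← MeasureTheory.integral_const_mul]
  congr 1
  funext lam
  ring

/-- Sum the diagonal Fourier identities over `|k| = n`: all have the same right-hand side, and their
number is the normalising binomial coefficient. -/
theorem IsL2Kernel.pairing_ell {d : ℕ} (hd : 1 ≤ d) {φ : ℝ → ℂ} {f : Pt d → ℂ}
    (hf : IsL2Kernel φ f) (n : ℕ) {ψ : ℝ → ℂ} (hψ : IsFreqTest ψ) :
    ∫ v, f v * ∫ lam, ψ lam * starRingEnd ℂ (ell n lam v)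
      = ∫ lam, ψ lam * φ (|lam| * ((d : ℝ) + 2 * (n : ℝ))) := by
  set b : ℂ := (((d - 1 + n).choose n : ℝ) : ℂ)
  have hb : b ≠ 0 := by
    simp only [b]
    exact_mod_cast (Nat.choose_pos (Nat.le_add_left n (d - 1))).ne'
  set S := Finset.finsuppAntidiag (Finset.univ : Finset (Fin d)) n
  have hmc : ∀ k : Fin d → ℕ, ∀ v : Pt d,
      MeasureTheory.Integrable fun lam => ψ lam * matrixCoeff k k lam v := by
    intro k v
    have h := ((rapidKernel_gaussKernel (d := d)).prod_laguerre_mul k Finset.univ).continuousOn v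
    refine (hψ.integrable_mul h).congr (Filter.Eventually.of_forall fun lam => ?_)
    rcases eq_or_ne lam 0 with rfl | hl
    · simp only [hψ.apply_zero, zero_mul]
    · simp only
      rw [matrixCoeff_self _ hl, gaussKernel]
      push_cast
      ring
  have h1 : ∀ v : Pt d, b * ∫ lam, ψ lam * starRingEnd ℂ (ell n lam v)
      = ∑ k ∈ S, ∫ lam, ψ lam * matrixCoeff (⇑k) (⇑k) lam v := by
    intro v
    rw [← MeasureTheory.integral_finsetSum S fun k _ => hmc k v, ← MeasureTheory.integral_const_mul]
    congr 1
    funext lam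
    rcases eq_or_ne lam 0 with rfl | hl
    · simp [hψ.apply_zero]
    · rw [← Finset.mul_sum, sum_matrixCoeff_self hd n hl]
      ring
  have h2 : b * ∫ v, f v * ∫ lam, ψ lam * starRingEnd ℂ (ell n lam v)
      = ∑ k ∈ S, ∫ v, f v * ∫ lam, ψ lam * matrixCoeff (⇑k) (⇑k) lam v := by
    rw [← MeasureTheory.integral_finsetSum S fun k _ =>
      integrable_mul_integral_matrixCoeff hf.memLp k hψ, ← MeasureTheory.integral_const_mul]
    congr 1
    funext v
    rw [← Finset.mul_sum, ← h1]
    ring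
  have h3 : ∀ k ∈ S, ∫ v, f v * ∫ lam, ψ lam * matrixCoeff (⇑k) (⇑k) lam v
      = ∫ lam, ψ lam * φ (|lam| * ((d : ℝ) + 2 * (n : ℝ))) := by
    intro k hk
    rw [hf.fourier k k ψ hψ]
    have : ∑ i, k i = n := by
      have := (Finset.mem_finsuppAntidiag.1 hk).1
      simpa using this
    simp only [multiplierMatrix, if_true, this]
  rw [Finset.sum_congr rfl h3, Finset.sum_const, nsmul_eq_mul] at h2
  have h4 : (S.card : ℂ) = b := by
    have := congrArg Complex.ofReal (card_finsuppAntidiag_fin hd n)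
    simpa [b] using this
  rw [h4] at h2
  exact mul_left_cancel₀ hb h2

/-- One factor `posPoly v` is spent on the averaged kernel, producing five pairings with new test
functions; the induction hypothesis applies to each. -/
theorem IsL2Kernel.pairing_posPoly_pow {d : ℕ} (hd : 1 ≤ d) {φ : ℝ → ℂ} {f : Pt d → ℂ}
    (hf : IsL2Kernel φ f) (m : ℕ) (hφ : ContDiffOn ℝ ((m : ℕ) : ℕ∞) φ (Set.Ioi 0)) (n : ℕ)
    {ψ : ℝ → ℂ} (hψ : IsFreqTest ψ) :
    ∫ v, posPoly v ^ m * f v * ∫ lam, ψ lam * starRingEnd ℂ (ell n lam v)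
      = ∫ lam, ψ lam * biradial d φ m n lam := by
  induction m generalizing n ψ with
  | zero => simpa [biradial] using hf.pairing_ell hd n hψ
  | succ m ih =>
    have hφ' : ContDiffOn ℝ ((m : ℕ) : ℕ∞) φ (Set.Ioi 0) :=
      hφ.of_le (by exact_mod_cast Nat.le_succ m)
    have hA := hψ.mul (contDiffOn_forwardCoeff d n)
    have hB := hψ.mul (contDiffOn_backwardCoeff n)
    have hc : ∀ k, ContinuousOn (biradial d φ m k) {0}ᶜ := fun k =>
      (contDiffOn_biradial hd m 0 hφ' k).continuousOn
    have hc' : ContinuousOn (deriv (biradial d φ m n)) {0}ᶜ :=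
      (contDiffOn_biradial hd m 1 hφ n).continuousOn_deriv_of_isOpen isOpen_compl_singleton (by simp)
    simp only [biradial]
    rw [integral_mul_difference d n hc hc' (fun lam hl => hasDerivAt_biradial hd m hφ n hl) hψ,
      ← ih hφ' n hψ.deriv, ← ih hφ' (n + 1) hA, ← ih hφ' n hA, ← ih hφ' n hB, ← ih hφ' (n - 1) hB]
    have hi : ∀ (k : ℕ) {χ : ℝ → ℂ}, IsFreqTest χ → MeasureTheory.Integrable
        (fun v : Pt d => posPoly v ^ m * f v * ∫ lam, χ lam * starRingEnd ℂ (ell k lam v))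
        MeasureTheory.volume := fun k χ hχ => integrable_posPoly_pow_mul hf.memLp m k hχ
    rw [← MeasureTheory.integral_neg,
      ← integral_sub_sub (g₀ := fun v : Pt d =>
        -(posPoly v ^ m * f v * ∫ lam, deriv ψ lam * starRingEnd ℂ (ell n lam v))) (hi _ hψ.deriv).neg (hi _ hA) (hi _ hA) (hi _ hB) (hi _ hB)]
    congr 1
    funext v
    rw [pow_succ, mul_assoc, mul_assoc, mul_left_comm (posPoly v), posPoly_mul_integral_conj_ell hd n v hψ]
    ring

theorem IsL2Kernel.isBiradialTransform {d : ℕ} (hd : 1 ≤ d) {φ : ℝ → ℂ} {f : Pt d → ℂ}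
    (hf : IsL2Kernel φ f) (m : ℕ) (hφ : ContDiffOn ℝ ((m : ℕ) : ℕ∞) φ (Set.Ioi 0)) :
    IsBiradialTransform (fun v => posPoly v ^ m * f v) (biradial d φ m) where
  cont n := (contDiffOn_biradial hd m 0 hφ n).continuousOn
  integrable n _ hψ := integrable_posPoly_pow_mul hf.memLp m n hψ
  pairing n _ hψ := hf.pairing_posPoly_pow hd m hφ n hψ

/-! ### Spline functionals -/

theorem hasDerivAt_integral_param {G G' : ℝ → ℝ → ℂ} (hG : Continuous (Function.uncurry G))
    (hG' : Continuous (Function.uncurry G'))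
    (hd : ∀ x σ, HasDerivAt (fun x => G x σ) (G' x σ) x) (x : ℝ) :
    HasDerivAt (fun x => ∫ σ in (0 : ℝ)..2, G x σ) (∫ σ in (0 : ℝ)..2, G' x σ) x := by
  obtain ⟨C, hC⟩ := ((isCompact_Icc (a := x - 1) (b := x + 1)).prod
    (isCompact_Icc (a := (0 : ℝ)) (b := 2))).exists_bound_of_continuousOn hG'.continuousOn
  have hG1 : ∀ y, Continuous (G y) := fun y => hG.comp (continuous_const.prodMk continuous_id)
  have hG1' : Continuous (G' x) := hG'.comp (continuous_const.prodMk continuous_id)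
  refine (intervalIntegral.hasDerivAt_integral_of_dominated_loc_of_deriv_le (bound := fun _ => C)
    (Icc_mem_nhds (by linarith : x - 1 < x) (by linarith : x < x + 1))
    (Filter.Eventually.of_forall fun y => (hG1 y).aestronglyMeasurable)
    ((hG1 x).intervalIntegrable _ _) hG1'.aestronglyMeasurable
    (Filter.Eventually.of_forall fun σ hσ y hy => hC (y, σ) ⟨hy, ?_⟩)
    (continuous_const.intervalIntegrable _ _)
    (Filter.Eventually.of_forall fun σ _ y _ => hd y σ)).2
  rw [Set.uIoc_of_le (by norm_num)] at hσ
  exact Set.Ioc_subset_Icc_self hσ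

/-- `h ↦ ∫₀² (2 - σ) h(· + σ) dσ`, which inverts a second-order difference. -/
def splineAverage (h : ℝ → ℂ) (τ : ℝ) : ℂ := ∫ σ in (0 : ℝ)..2, (2 - σ : ℂ) * h (τ + σ)

theorem continuous_splineAverage {h : ℝ → ℂ} (hh : Continuous h) : Continuous (splineAverage h) := by
  unfold splineAverage
  refine intervalIntegral.continuous_parametric_intervalIntegral_of_continuous' ?_ _ _
  unfold Function.uncurry
  fun_prop

theorem norm_integral_zero_two_le {g : ℝ → ℂ} {M : ℝ} (hg : ∀ σ ∈ Set.Icc (0 : ℝ) 2, ‖g σ‖ ≤ M) :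
    ‖∫ σ in (0 : ℝ)..2, g σ‖ ≤ 2 * M := by
  have := intervalIntegral.norm_integral_le_of_norm_le_const (f := g) (a := 0) (b := 2) (C := M)
    fun σ hσ => by
      rw [Set.uIoc_of_le (by norm_num)] at hσ
      exact hg σ (Set.Ioc_subset_Icc_self hσ)
  rw [sub_zero, abs_of_pos (by norm_num : (0 : ℝ) < 2)] at this
  linarith

theorem norm_splineAverage_le {h : ℝ → ℂ} {M R : ℝ} (hh : ∀ τ ∈ Set.Icc 0 (R + 2), ‖h τ‖ ≤ M)
    {τ : ℝ} (hτ : τ ∈ Set.Icc 0 R) : ‖splineAverage h τ‖ ≤ 4 * M := by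
  have := norm_integral_zero_two_le (g := fun σ => (2 - σ : ℂ) * h (τ + σ)) (M := 2 * M)
    fun σ hσ => by
      have h1 : ‖(2 - σ : ℂ)‖ ≤ 2 := by
        rw [show (2 - σ : ℂ) = ((2 - σ : ℝ) : ℂ) by push_cast; rfl, Complex.norm_real,
          Real.norm_of_nonneg (by linarith [hσ.2])]
        linarith [hσ.1]
      rw [norm_mul]
      exact mul_le_mul h1 (hh _ ⟨by linarith [hτ.1, hσ.1], by linarith [hτ.2, hσ.2]⟩)
        (norm_nonneg _) (by norm_num)
  rw [splineAverage]
  linarith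

/-- Integration by parts; the weight `2 - σ` kills the boundary term at `σ = 2`. -/
theorem splineAverage_deriv {H₀ H₁ : ℝ → ℂ} (h₀ : ∀ τ, HasDerivAt H₀ (H₁ τ) τ)
    (hc : Continuous H₁) (τ : ℝ) :
    splineAverage H₁ τ = -2 * H₀ τ + ∫ σ in (0 : ℝ)..2, H₀ (τ + σ) := by
  have hc₀ : Continuous H₀ := continuous_iff_continuousAt.2 fun x => (h₀ x).continuousAt
  have h1 : ∀ σ : ℝ, HasDerivAt (fun σ : ℝ => (2 - σ : ℂ) * H₀ (τ + σ))
      (-1 * H₀ (τ + σ) + (2 - σ : ℂ) * H₁ (τ + σ)) σ := fun σ =>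
    ((HasDerivAt.ofReal_comp (hasDerivAt_id σ)).const_sub (2 : ℂ)).mul
      ((h₀ (τ + σ)).comp_const_add τ σ) |>.congr_deriv (by simp)
  have i1 : IntervalIntegrable (fun σ : ℝ => -1 * H₀ (τ + σ)) MeasureTheory.volume 0 2 :=
    Continuous.intervalIntegrable (by fun_prop) _ _
  have i2 : IntervalIntegrable (fun σ : ℝ => (2 - σ : ℂ) * H₁ (τ + σ)) MeasureTheory.volume 0 2 :=
    Continuous.intervalIntegrable (by fun_prop) _ _
  have h2 := intervalIntegral.integral_eq_sub_of_hasDerivAt (fun σ _ => h1 σ) (i1.add i2)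
  rw [intervalIntegral.integral_add i1 i2, intervalIntegral.integral_const_mul] at h2
  rw [splineAverage]
  simp only [Complex.ofReal_zero, Complex.ofReal_ofNat, add_zero] at h2
  linear_combination h2

/-- Taylor's formula of second order with integral remainder, for a step of length 2. -/
theorem splineAverage_deriv_two {H₀ H₁ H₂ : ℝ → ℂ} (h₀ : ∀ τ, HasDerivAt H₀ (H₁ τ) τ)
    (h₁ : ∀ τ, HasDerivAt H₁ (H₂ τ) τ) (hc : Continuous H₂) (τ : ℝ) :
    splineAverage H₂ τ = H₀ (τ + 2) - H₀ τ - 2 * H₁ τ := by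
  have hc₁ : Continuous H₁ := continuous_iff_continuousAt.2 fun x => (h₁ x).continuousAt
  rw [splineAverage_deriv h₁ hc]
  have h2 := intervalIntegral.integral_eq_sub_of_hasDerivAt (f := fun σ => H₀ (τ + σ))
    (f' := fun σ => H₁ (τ + σ)) (a := 0) (b := 2) (fun σ _ => (h₀ (τ + σ)).comp_const_add τ σ)
    (Continuous.intervalIntegrable (by fun_prop) _ _)
  rw [h2, add_zero]
  ring

/-- The functionals through which the `(m+l)`-th derivative of the multiplier enters the biradial
transform of `(i s - |z|² / 4)^m φ(-Δ)δ`; they are integrals against splines supported in `[0, 2m]`. -/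
def splineFunctional (d : ℕ) : ℕ → ℕ → (ℝ → ℂ) → ℂ
  | 0, 0, h => h 0
  | 0, _ + 1, _ => 0
  | m + 1, 0, h => splineFunctional d m 0 fun τ => (d - τ : ℂ) * h τ
  | m + 1, l + 1, h => splineFunctional d m (l + 1) (fun τ => (d + 2 * (l + 1) - τ : ℂ) * h τ)
      + splineFunctional d m l (splineAverage h)

theorem splineFunctional_of_lt (d : ℕ) {m l : ℕ} (h : m < l) (g : ℝ → ℂ) :
    splineFunctional d m l g = 0 := by
  induction m generalizing l g with
  | zero =>
    obtain ⟨l, rfl⟩ := Nat.exists_eq_succ_of_ne_zero h.ne'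
    rfl
  | succ m ih =>
    obtain ⟨l, rfl⟩ := Nat.exists_eq_succ_of_ne_zero (Nat.ne_zero_of_lt h)
    rw [splineFunctional, ih (by omega), ih (by omega), add_zero]

theorem splineFunctional_const_mul (d m l : ℕ) (c : ℂ) (g : ℝ → ℂ) :
    splineFunctional d m l (fun τ => c * g τ) = c * splineFunctional d m l g := by
  induction m generalizing l g with
  | zero => cases l <;> simp [splineFunctional]
  | succ m ih =>
    cases l with
    | zero =>
      simp only [splineFunctional]
      rw [← ih]
      simp only [mul_left_comm]
    | succ l =>
      have : splineAverage (fun τ => c * g τ) = fun τ => c * splineAverage g τ := by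
        funext τ
        simp only [splineAverage]
        rw [← intervalIntegral.integral_const_mul]
        simp only [mul_left_comm]
      simp only [splineFunctional]
      rw [this, mul_add c, ← ih, ← ih]
      simp only [mul_left_comm]

theorem splineFunctional_add (d m l : ℕ) {g h : ℝ → ℂ} (hg : Continuous g) (hh : Continuous h) :
    splineFunctional d m l (fun τ => g τ + h τ)
      = splineFunctional d m l g + splineFunctional d m l h := by
  induction m generalizing l g h with
  | zero => cases l <;> simp [splineFunctional]
  | succ m ih =>
    cases l with
    | zero =>
      simp only [splineFunctional, mul_add]
      exact ih 0 (by fun_prop) (by fun_prop)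
    | succ l =>
      have : splineAverage (fun τ => g τ + h τ) = fun τ => splineAverage g τ + splineAverage h τ := by
        funext τ
        simp only [splineAverage, mul_add]
        exact intervalIntegral.integral_add (Continuous.intervalIntegrable (by fun_prop) _ _)
          (Continuous.intervalIntegrable (by fun_prop) _ _)
      simp only [splineFunctional, mul_add]
      rw [this, ih l (continuous_splineAverage hg) (continuous_splineAverage hh),
        ih (l + 1) (by fun_prop) (by fun_prop)]
      ring

theorem hasDerivAt_splineFunctional (d m l : ℕ) {G G' : ℝ → ℝ → ℂ}
    (hG : Continuous (Function.uncurry G)) (hG' : Continuous (Function.uncurry G'))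
    (hd : ∀ x τ, HasDerivAt (fun x => G x τ) (G' x τ) x) (x : ℝ) :
    HasDerivAt (fun x => splineFunctional d m l (G x)) (splineFunctional d m l (G' x)) x := by
  induction m generalizing l G G' with
  | zero =>
    cases l with
    | zero => exact hd x 0
    | succ l => exact hasDerivAt_const x 0
  | succ m ih =>
    have hmul : ∀ c : ℂ, Continuous (Function.uncurry fun x τ => (c - (τ : ℝ)) * G x τ)
        ∧ Continuous (Function.uncurry fun x τ => (c - (τ : ℝ)) * G' x τ) := by
      intro c
      unfold Function.uncurry at *
      constructor <;> fun_prop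
    cases l with
    | zero => exact ih 0 (hmul d).1 (hmul d).2 fun x τ => (hd x τ).const_mul _
    | succ l =>
      have hs : ∀ {F : ℝ → ℝ → ℂ}, Continuous (Function.uncurry F) →
          Continuous (Function.uncurry fun x => splineAverage (F x)) := by
        intro F hF
        unfold splineAverage
        refine intervalIntegral.continuous_parametric_intervalIntegral_of_continuous'
          (f := fun (p : ℝ × ℝ) σ => (2 - σ : ℂ) * F p.1 (p.2 + σ)) ?_ _ _
        have : Continuous fun q : (ℝ × ℝ) × ℝ => F q.1.1 (q.1.2 + q.2) :=
          hF.comp (f := fun q : (ℝ × ℝ) × ℝ => (q.1.1, q.1.2 + q.2)) (by fun_prop)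
        unfold Function.uncurry
        fun_prop
      refine (ih (l + 1) (hmul _).1 (hmul _).2 fun x τ => (hd x τ).const_mul _).add
        (ih l (hs hG) (hs hG') fun x τ => ?_)
      unfold splineAverage
      refine hasDerivAt_integral_param (G := fun x σ => (2 - σ : ℂ) * G x (τ + σ))
        (G' := fun x σ => (2 - σ : ℂ) * G' x (τ + σ)) ?_ ?_ (fun x σ => (hd x (τ + σ)).const_mul _) x
      · have : Continuous fun q : ℝ × ℝ => G q.1 (τ + q.2) :=
          hG.comp (f := fun q : ℝ × ℝ => (q.1, τ + q.2)) (by fun_prop)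
        unfold Function.uncurry
        fun_prop
      · have : Continuous fun q : ℝ × ℝ => G' q.1 (τ + q.2) :=
          hG'.comp (f := fun q : ℝ × ℝ => (q.1, τ + q.2)) (by fun_prop)
        unfold Function.uncurry
        fun_prop

theorem norm_sub_ofReal_mul_le {c : ℂ} {h : ℝ → ℂ} {R M τ : ℝ} (hτ : τ ∈ Set.Icc 0 R)
    (hh : ‖h τ‖ ≤ M) : ‖(c - τ) * h τ‖ ≤ (‖c‖ + R) * M := by
  have h1 : ‖c - (τ : ℂ)‖ ≤ ‖c‖ + R := by
    refine (norm_sub_le _ _).trans ?_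
    rw [Complex.norm_real, Real.norm_of_nonneg hτ.1]
    linarith [hτ.2]
  rw [norm_mul]
  exact mul_le_mul h1 hh (norm_nonneg _) ((norm_nonneg _).trans h1)

/-- Each level multiplies by a weight bounded on the support or averages over a window of length 2,
so `m` levels see only `[0, 2m]`. -/
theorem norm_splineFunctional_le (d m l : ℕ) :
    ∃ C : ℝ, 0 ≤ C ∧ ∀ (h : ℝ → ℂ) (M : ℝ), (∀ τ ∈ Set.Icc (0 : ℝ) (2 * m), ‖h τ‖ ≤ M) →
      ‖splineFunctional d m l h‖ ≤ C * M := by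
  induction m generalizing l with
  | zero =>
    cases l with
    | zero =>
      refine ⟨1, zero_le_one, fun h M hM => ?_⟩
      rw [one_mul]
      exact hM 0 (by simp)
    | succ l =>
      refine ⟨0, le_rfl, fun h M hM => ?_⟩
      simp [splineFunctional]
  | succ m ih =>
    have hsub : ∀ {τ : ℝ}, τ ∈ Set.Icc (0 : ℝ) (2 * m) → τ ∈ Set.Icc (0 : ℝ) (2 * (m + 1 : ℕ)) := by
      intro τ hτ
      refine ⟨hτ.1, hτ.2.trans ?_⟩
      push_cast
      linarith
    cases l with
    | zero =>
      obtain ⟨C, hC0, hC⟩ := ih 0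
      refine ⟨C * (‖(d : ℂ)‖ + 2 * m), by positivity, fun h M hM => ?_⟩
      rw [mul_assoc]
      exact hC _ _ fun τ hτ => norm_sub_ofReal_mul_le hτ (hM τ (hsub hτ))
    | succ l =>
      obtain ⟨C, hC0, hC⟩ := ih (l + 1)
      obtain ⟨D, hD0, hD⟩ := ih l
      refine ⟨C * (‖(d + 2 * (l + 1) : ℂ)‖ + 2 * m) + D * 4, by positivity, fun h M hM => ?_⟩
      rw [splineFunctional, add_mul, mul_assoc, mul_assoc]
      refine (norm_add_le _ _).trans (add_le_add ?_ ?_)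
      · exact hC _ _ fun τ hτ => norm_sub_ofReal_mul_le hτ (hM τ (hsub hτ))
      · refine hD _ _ fun τ hτ => norm_splineAverage_le (fun τ hτ => hM τ ?_) hτ
        push_cast
        rwa [mul_add, mul_one]

/-- Integrating by parts `k ≤ l` times against a spline of order `l`. -/
theorem norm_splineFunctional_deriv_le (d m l : ℕ) :
    ∃ C : ℝ, 0 ≤ C ∧ ∀ (k : ℕ), k ≤ l → ∀ (H : ℕ → ℝ → ℂ) (M : ℝ),
      (∀ i < k, ∀ τ, HasDerivAt (H i) (H (i + 1) τ) τ) → (∀ i ≤ k, Continuous (H i)) →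
      (∀ τ ∈ Set.Icc (0 : ℝ) (2 * m), ‖H 0 τ‖ ≤ M) → ‖splineFunctional d m l (H k)‖ ≤ C * M := by
  induction m generalizing l with
  | zero =>
    cases l with
    | zero =>
      refine ⟨1, zero_le_one, fun k hk H M _ _ hM => ?_⟩
      obtain rfl := Nat.le_zero.1 hk
      rw [one_mul]
      exact hM 0 (by simp)
    | succ l =>
      refine ⟨0, le_rfl, fun k _ H M _ _ hM => ?_⟩
      simp [splineFunctional]
  | succ m ih =>
    have hsub : ∀ {τ : ℝ}, τ ∈ Set.Icc (0 : ℝ) (2 * m) → τ ∈ Set.Icc (0 : ℝ) (2 * (m + 1 : ℕ)) := by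
      intro τ hτ
      refine ⟨hτ.1, hτ.2.trans ?_⟩
      push_cast
      linarith
    cases l with
    | zero =>
      obtain ⟨C, hC0, hC⟩ := norm_splineFunctional_le d (m + 1) 0
      refine ⟨C, hC0, fun k hk H M _ _ hM => ?_⟩
      obtain rfl := Nat.le_zero.1 hk
      exact hC _ _ hM
    | succ l =>
      obtain ⟨C, hC0, hC⟩ := ih (l + 1)
      obtain ⟨D, hD0, hD⟩ := ih l
      set c : ℂ := d + 2 * (l + 1)
      refine ⟨C * (‖c‖ + 2 * m) + (l + 1) * C + D * 4, by positivity, fun k hk H M hd hc hM => ?_⟩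
      have hM0 : 0 ≤ M := (norm_nonneg _).trans (hM 0 ⟨le_rfl, by positivity⟩)
      have hM' : ∀ τ ∈ Set.Icc (0 : ℝ) (2 * m), ‖H 0 τ‖ ≤ M := fun τ hτ => hM τ (hsub hτ)
      have hM2 : ∀ τ ∈ Set.Icc (0 : ℝ) (2 * m + 2), ‖H 0 τ‖ ≤ M := fun τ hτ => hM τ (by
        push_cast
        rwa [mul_add, mul_one])
      have t1 : ‖splineFunctional d m (l + 1) (fun τ => (c - τ) * H k τ)‖
          ≤ (C * (‖c‖ + 2 * m) + (l + 1) * C) * M := by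
        -- By Leibniz `J i` is the `i`-th derivative of `(c - τ) H 0`, and the correction `k H
        -- (k-1)` has fewer derivatives, so the induction hypothesis handles both.
        set J : ℕ → ℝ → ℂ := fun i τ => (c - τ) * H i τ - i * H (i - 1) τ
        have hJc : ∀ i ≤ k, Continuous (J i) := by
          intro i hi
          have h1 := hc i hi
          have h2 := hc (i - 1) (by omega)
          simp only [J]
          fun_prop
        have hJd : ∀ i < k, ∀ τ, HasDerivAt (J i) (J (i + 1) τ) τ := by
          intro i hi τ
          have h1 : HasDerivAt (fun τ : ℝ => (c - τ) * H i τ) (-1 * H i τ + (c - τ) * H (i + 1) τ) τ :=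
            ((HasDerivAt.ofReal_comp (hasDerivAt_id τ)).const_sub c).mul (hd i hi τ)
              |>.congr_deriv (by simp)
          cases i with
          | zero =>
            refine (h1.congr_of_eventuallyEq (Filter.Eventually.of_forall fun y => ?_)).congr_deriv ?_
            · simp [J]
            · simp [J]
              ring
          | succ i =>
            refine (h1.sub ((hd i (by omega) τ).const_mul ((i + 1 : ℕ) : ℂ))).congr_deriv ?_
            simp only [J, Nat.add_sub_cancel]
            push_cast
            ring
        have b1 : ‖splineFunctional d m (l + 1) (J k)‖ ≤ C * ((‖c‖ + 2 * m) * M) :=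
          hC k hk J _ hJd hJc fun τ hτ => by
            simp only [J, Nat.cast_zero, zero_mul, sub_zero]
            exact norm_sub_ofReal_mul_le hτ (hM' τ hτ)
        have b2 : ‖splineFunctional d m (l + 1) (H (k - 1))‖ ≤ C * M :=
          hC (k - 1) (by omega) H M (fun i hi => hd i (by omega)) (fun i hi => hc i (by omega)) hM'
        have heq : (fun τ : ℝ => (c - τ) * H k τ) = fun τ => J k τ + k * H (k - 1) τ := by
          funext τ
          simp only [J]
          ring
        have hcH := hc (k - 1) (by omega)
        rw [heq, splineFunctional_add d m (l + 1) (hJc k le_rfl) (by fun_prop),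
          splineFunctional_const_mul]
        refine (norm_add_le _ _).trans ?_
        rw [norm_mul, Complex.norm_natCast]
        have hk' : (k : ℝ) ≤ l + 1 := by exact_mod_cast hk
        calc _ ≤ C * ((‖c‖ + 2 * m) * M) + (l + 1) * (C * M) := by gcongr
          _ = _ := by ring
      have t2 : ‖splineFunctional d m l (splineAverage (H k))‖ ≤ D * (4 * M) := by
        cases k with
        | zero =>
          exact hD 0 (Nat.zero_le _) (fun _ => splineAverage (H 0)) _ (fun i hi => by omega)
            (fun _ _ => continuous_splineAverage (hc 0 le_rfl))
            fun τ hτ => norm_splineAverage_le hM2 hτ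
        | succ k =>
          -- The average absorbs one of the `k + 1` derivatives, leaving `k ≤ l` for the spline of
          -- order `l`.
          set J : ℕ → ℝ → ℂ := fun i τ => -2 * H i τ + ∫ σ in (0 : ℝ)..2, H i (τ + σ)
          have heq : splineAverage (H (k + 1)) = J k :=
            funext fun τ => splineAverage_deriv (hd k (by omega)) (hc (k + 1) le_rfl) τ
          have hcu : ∀ i ≤ k + 1, Continuous (Function.uncurry fun τ σ => H i (τ + σ)) := by
            intro i hi
            have := hc i hi
            unfold Function.uncurry
            fun_prop
          rw [heq]
          refine hD k (by omega) J _ (fun i hi τ => ?_) (fun i hi => ?_) fun τ hτ => ?_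
          · exact ((hd i (by omega) τ).const_mul (-2)).add (hasDerivAt_integral_param
              (hcu i (by omega)) (hcu (i + 1) (by omega))
              (fun x σ => (hd i (by omega) (x + σ)).comp_add_const x σ) τ)
          · exact (continuous_const.mul (hc i (by omega))).add
              (intervalIntegral.continuous_parametric_intervalIntegral_of_continuous'
                (hcu i (by omega)) _ _)
          · have h1 := hM2 τ ⟨hτ.1, by linarith [hτ.2]⟩
            have h2 := norm_integral_zero_two_le (g := fun σ => H 0 (τ + σ)) (M := M) fun σ hσ =>
              hM2 _ ⟨by linarith [hτ.1, hσ.1], by linarith [hτ.2, hσ.2]⟩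
            refine (norm_add_le _ _).trans ?_
            rw [norm_mul, norm_neg, Complex.norm_ofNat]
            linarith
      rw [splineFunctional]
      refine (norm_add_le _ _).trans ?_
      linarith

/-! ### Spline representation and estimate of the biradial transform -/

/-- The falling factorial `a (a - 1) ⋯ (a - l + 1)`. -/
def fallingFactorial (a : ℝ) (l : ℕ) : ℝ := ∏ j ∈ Finset.range l, (a - j)

theorem fallingFactorial_succ (a : ℝ) (l : ℕ) :
    fallingFactorial a (l + 1) = fallingFactorial a l * (a - l) :=
  Finset.prod_range_succ _ _

theorem fallingFactorial_succ' (a : ℝ) (l : ℕ) :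
    fallingFactorial a (l + 1) = a * fallingFactorial (a - 1) l := by
  rw [fallingFactorial, Finset.prod_range_succ', mul_comm, Nat.cast_zero, sub_zero, fallingFactorial]
  congr 1
  refine Finset.prod_congr rfl fun j _ => ?_
  push_cast
  ring

theorem abs_fallingFactorial_le {a B : ℝ} (l : ℕ) (h : |a| + l ≤ B) :
    |fallingFactorial a l| ≤ B ^ l := by
  rw [fallingFactorial, Finset.abs_prod]
  refine (Finset.prod_le_prod (fun _ _ => abs_nonneg _) fun j hj => ?_).trans_eq
    (by rw [Finset.prod_const, Finset.card_range])
  have h1 : (j : ℝ) ≤ l := by exact_mod_cast (Finset.mem_range.1 hj).le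
  have h2 := norm_sub_le a (j : ℝ)
  rw [Real.norm_eq_abs, Real.norm_eq_abs, Real.norm_natCast] at h2
  linarith

/-- The spline representation of `(∂_λ - (a/λ) ∇_a)^m Φ(λ (d + 2 a))`, with `∇_a` the backward
difference in `a`. -/
def splineSum (d : ℕ) (Φ : ℝ → ℂ) (m : ℕ) (a lam : ℝ) : ℂ :=
  ∑ l ∈ Finset.range (m + 1), ((fallingFactorial a l * lam ^ l : ℝ) : ℂ)
    * splineFunctional d m l fun τ => iteratedDeriv (m + l) Φ (lam * (d + 2 * a - τ))

theorem hasDerivAt_iteratedDeriv {Φ : ℝ → ℂ} {N j : ℕ} (hΦ : ContDiff ℝ ((N : ℕ) : ℕ∞) Φ)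
    (hj : j < N) (x : ℝ) : HasDerivAt (iteratedDeriv j Φ) (iteratedDeriv (j + 1) Φ x) x := by
  rw [iteratedDeriv_succ]
  exact (hΦ.differentiable_iteratedDeriv j (by exact_mod_cast hj) x).hasDerivAt

theorem continuous_iteratedDeriv_of_le {Φ : ℝ → ℂ} {N j : ℕ} (hΦ : ContDiff ℝ ((N : ℕ) : ℕ∞) Φ)
    (hj : j ≤ N) : Continuous (iteratedDeriv j Φ) :=
  hΦ.continuous_iteratedDeriv j (by exact_mod_cast hj)

/-- Unfold the recursion of the functionals and collect by their index at level `m`; the extra top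
term vanishes because its order exceeds `m`. -/
theorem splineSum_succ (d : ℕ) (Φ : ℝ → ℂ) (m : ℕ) (a lam : ℝ) :
    splineSum d Φ (m + 1) a lam = ∑ l ∈ Finset.range (m + 1),
      (((fallingFactorial a l * lam ^ l : ℝ) : ℂ) * splineFunctional d m l (fun τ =>
          (d + 2 * l - τ : ℂ) * iteratedDeriv (m + l + 1) Φ (lam * (d + 2 * a - τ)))
        + ((fallingFactorial a (l + 1) * lam ^ (l + 1) : ℝ) : ℂ) * splineFunctional d m l
          (splineAverage fun τ => iteratedDeriv (m + l + 2) Φ (lam * (d + 2 * a - τ)))) := by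
  rw [splineSum, Finset.sum_range_succ', Finset.sum_add_distrib]
  have h1 : ∀ l, splineFunctional d (m + 1) (l + 1)
      (fun τ => iteratedDeriv (m + 1 + (l + 1)) Φ (lam * (d + 2 * a - τ)))
      = splineFunctional d m (l + 1) (fun τ =>
          (d + 2 * ((l + 1 : ℕ) : ℂ) - τ : ℂ) * iteratedDeriv (m + (l + 1) + 1) Φ (lam * (d + 2 * a - τ)))
        + splineFunctional d m l
          (splineAverage fun τ => iteratedDeriv (m + l + 2) Φ (lam * (d + 2 * a - τ))) := by
    intro l
    rw [splineFunctional, show m + 1 + (l + 1) = m + l + 2 by ring,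
      show m + (l + 1) + 1 = m + l + 2 by ring]
    push_cast
    rfl
  have h2 : splineFunctional d (m + 1) 0
      (fun τ => iteratedDeriv (m + 1 + 0) Φ (lam * (d + 2 * a - τ)))
      = splineFunctional d m 0 (fun τ =>
          (d + 2 * ((0 : ℕ) : ℂ) - τ : ℂ) * iteratedDeriv (m + 0 + 1) Φ (lam * (d + 2 * a - τ))) := by
    rw [splineFunctional]
    simp
  simp only [h1, h2, mul_add, Finset.sum_add_distrib]
  rw [add_right_comm, ← Finset.sum_range_succ' (fun l =>
    ((fallingFactorial a l * lam ^ l : ℝ) : ℂ) * splineFunctional d m l (fun τ =>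
          (d + 2 * (l : ℂ) - τ : ℂ) * iteratedDeriv (m + l + 1) Φ (lam * (d + 2 * a - τ)))) (m + 1),
    Finset.sum_range_succ _ (m + 1), splineFunctional_of_lt d (Nat.lt_succ_self m), mul_zero, add_zero]

/-- Replacing `a` by `a - 1` shifts `τ` by 2, so Taylor's formula writes the difference in `a`
through `H₀`, `H₁` and an average of `H₂`. By `a (a-1)_l = (a)_l (a - l)`, with `(a)_l` the falling
factorial, the `H₀` terms cancel against the derivative of `λ^l`. The `H₁` terms cancel against the
part `2(a - l)` of the weight `d + 2a - τ`. The rest is the next spline sum. -/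
theorem hasDerivAt_splineSum (d : ℕ) {Φ : ℝ → ℂ} {m : ℕ}
    (hΦ : ContDiff ℝ ((2 * (m + 1) : ℕ) : ℕ∞) Φ) (a : ℝ) {lam : ℝ} (hl : lam ≠ 0) :
    HasDerivAt (splineSum d Φ m a) (splineSum d Φ (m + 1) a lam
      + ((a / lam : ℝ) : ℂ) * (splineSum d Φ m a lam - splineSum d Φ m (a - 1) lam)) lam := by
  have hlc : (lam : ℂ) ≠ 0 := by exact_mod_cast hl
  have hdef : splineSum d Φ m a = fun lam => ∑ l ∈ Finset.range (m + 1),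
      ((fallingFactorial a l * lam ^ l : ℝ) : ℂ)
        * splineFunctional d m l fun τ => iteratedDeriv (m + l) Φ (lam * (d + 2 * a - τ)) := rfl
  rw [splineSum_succ, splineSum, splineSum, ← Finset.sum_sub_distrib, Finset.mul_sum,
    ← Finset.sum_add_distrib, hdef]
  refine HasDerivAt.fun_sum fun l hlm => ?_
  have hlm' : l ≤ m := Nat.lt_succ_iff.1 (Finset.mem_range.1 hlm)
  have hc0 := continuous_iteratedDeriv_of_le hΦ (j := m + l) (by omega)
  have hc1 := continuous_iteratedDeriv_of_le hΦ (j := m + l + 1) (by omega)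
  have hc2 := continuous_iteratedDeriv_of_le hΦ (j := m + l + 2) (by omega)
  set T := splineFunctional d m l
  have hTadd : ∀ {g h : ℝ → ℂ}, Continuous g → Continuous h → T (fun τ => g τ + h τ) = T g + T h :=
    splineFunctional_add d m l
  have hTmul : ∀ (c : ℂ) (g : ℝ → ℂ), T (fun τ => c * g τ) = c * T g :=
    splineFunctional_const_mul d m l
  set H₀ : ℝ → ℂ := fun τ => iteratedDeriv (m + l) Φ (lam * (d + 2 * a - τ))
  set H₁ : ℝ → ℂ := fun τ => iteratedDeriv (m + l + 1) Φ (lam * (d + 2 * a - τ))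
  set H₂ : ℝ → ℂ := fun τ => iteratedDeriv (m + l + 2) Φ (lam * (d + 2 * a - τ))
  have hH₀ : Continuous H₀ := by fun_prop
  have hH₁ : Continuous H₁ := by fun_prop
  have hH₂ : Continuous H₂ := by fun_prop
  have hdT : HasDerivAt (fun lam : ℝ => T fun τ => iteratedDeriv (m + l) Φ (lam * (d + 2 * a - τ)))
      (T fun τ => ((d + 2 * a - τ : ℝ) : ℂ) * H₁ τ) lam := by
    refine hasDerivAt_splineFunctional d m l
      (G := fun lam τ => iteratedDeriv (m + l) Φ (lam * (d + 2 * a - τ)))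
      (G' := fun lam τ => ((d + 2 * a - τ : ℝ) : ℂ)
        * iteratedDeriv (m + l + 1) Φ (lam * (d + 2 * a - τ))) ?_ ?_ (fun x τ => ?_) lam
    · unfold Function.uncurry
      fun_prop
    · unfold Function.uncurry
      fun_prop
    · have h1 := (hasDerivAt_iteratedDeriv hΦ (j := m + l) (by omega)
        (x * (d + 2 * a - τ))).scomp x ((hasDerivAt_id x).mul_const (d + 2 * a - τ))
      rw [one_mul, Complex.real_smul] at h1
      exact h1
  have hdp : HasDerivAt (fun lam : ℝ => ((fallingFactorial a l * lam ^ l : ℝ) : ℂ))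
      ((fallingFactorial a l * (l * lam ^ l / lam) : ℝ) : ℂ) lam := by
    refine (((hasDerivAt_pow l lam).const_mul (fallingFactorial a l)).congr_deriv ?_).ofReal_comp
    cases l with
    | zero => simp
    | succ l =>
      rw [pow_succ lam l, Nat.add_sub_cancel]
      field_simp
  have hsplit : (T fun τ => ((d + 2 * a - τ : ℝ) : ℂ) * H₁ τ)
      = T (fun τ => (d + 2 * l - τ : ℂ) * H₁ τ) + (2 * (a - l) : ℂ) * T H₁ := by
    rw [← hTmul, ← hTadd (by fun_prop) (by fun_prop)]
    congr 1
    funext τ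
    push_cast
    ring
  have hshift : (T fun τ => iteratedDeriv (m + l) Φ (lam * (d + 2 * (a - 1) - τ)))
      = T H₀ - 2 * lam * T H₁ + lam ^ 2 * T (splineAverage H₂) := by
    have hlin : ∀ τ : ℝ, HasDerivAt (fun τ : ℝ => lam * (d + 2 * a - τ)) (-lam) τ := fun τ => by
      simpa using ((hasDerivAt_id τ).const_sub (d + 2 * a)).const_mul lam
    have d0 : ∀ τ, HasDerivAt H₀ (-lam * H₁ τ) τ := fun τ => by
      have h1 := (hasDerivAt_iteratedDeriv hΦ (j := m + l) (by omega)
        (lam * (d + 2 * a - τ))).scomp τ (hlin τ)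
      rw [Complex.real_smul, Complex.ofReal_neg] at h1
      exact h1
    have d1 : ∀ τ, HasDerivAt (fun τ => -(lam : ℂ) * H₁ τ) (lam ^ 2 * H₂ τ) τ := fun τ => by
      have h1 := ((hasDerivAt_iteratedDeriv hΦ (j := m + l + 1) (by omega)
        (lam * (d + 2 * a - τ))).scomp τ (hlin τ)).const_mul (-(lam : ℂ))
      rw [Complex.real_smul, Complex.ofReal_neg] at h1
      refine h1.congr_deriv ?_
      simp only [H₂]
      ring
    have hav : splineAverage (fun τ => (lam : ℂ) ^ 2 * H₂ τ) = fun τ => (lam : ℂ) ^ 2 * splineAverage H₂ τ := by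
      funext τ
      simp only [splineAverage]
      rw [← intervalIntegral.integral_const_mul]
      simp only [mul_left_comm]
    have hpt : (fun τ => iteratedDeriv (m + l) Φ (lam * (d + 2 * (a - 1) - τ)))
        = fun τ => (H₀ τ + -(2 * lam : ℂ) * H₁ τ) + lam ^ 2 * splineAverage H₂ τ := by
      funext τ
      have h2 := splineAverage_deriv_two d0 d1 (by fun_prop) τ
      rw [hav] at h2
      have h3 : iteratedDeriv (m + l) Φ (lam * (d + 2 * (a - 1) - τ)) = H₀ (τ + 2) := by
        simp only [H₀]
        congr 1
        ring
      rw [h3]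
      linear_combination -h2
    have hsc := continuous_splineAverage hH₂
    rw [hpt, hTadd (g := fun τ => H₀ τ + -(2 * lam : ℂ) * H₁ τ)
      (h := fun τ => (lam : ℂ) ^ 2 * splineAverage H₂ τ) (by fun_prop) (by fun_prop),
      hTadd (g := H₀) (h := fun τ => -(2 * lam : ℂ) * H₁ τ) hH₀ (by fun_prop), hTmul, hTmul]
    ring
  refine (hdp.mul hdT).congr_deriv ?_
  rw [hsplit, hshift]
  have hf : a * fallingFactorial (a - 1) l = fallingFactorial a l * (a - l) := by
    rw [← fallingFactorial_succ', fallingFactorial_succ]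
  have hfc : (a : ℂ) * (fallingFactorial (a - 1) l : ℝ) = (fallingFactorial a l : ℝ) * (a - l) := by
    exact_mod_cast congrArg Complex.ofReal hf
  rw [fallingFactorial_succ]
  push_cast
  field_simp
  linear_combination ((lam : ℂ) ^ l * (T H₀ - 2 * lam * T H₁ + lam ^ 2 * T (splineAverage H₂))) * hfc

/-- With this choice of `a`, `λ(d + 2a) = |λ|(d + 2n)`, and raising `n` for `λ < 0` lowers `a`. Both
branches of the recursion thus become the operator in `hasDerivAt_splineSum`. -/
theorem biradial_eq_splineSum {d : ℕ} {φ Φ : ℝ → ℂ} (m : ℕ)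
    (hΦ : ContDiff ℝ ((2 * m : ℕ) : ℕ∞) Φ) (h : Set.EqOn Φ φ (Set.Ici 0)) (n : ℕ) {lam : ℝ}
    (hl : lam ≠ 0) :
    biradial d φ m n lam = splineSum d Φ m (if 0 < lam then (n : ℝ) else -n - d) lam := by
  induction m generalizing n lam with
  | zero =>
    have h0 : (0 : ℝ) ≤ |lam| * (d + 2 * n) := by positivity
    simp only [biradial, splineSum, zero_add, Finset.sum_range_one, fallingFactorial,
      Finset.range_zero, Finset.prod_empty, pow_zero, mul_one, Complex.ofReal_one, one_mul,
      splineFunctional, iteratedDeriv_zero, sub_zero]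
    rw [← h h0]
    congr 1
    split_ifs with hpos
    · rw [abs_of_pos hpos]
    · rw [abs_of_nonpos (not_lt.1 hpos)]
      ring
  | succ m ih =>
    have hΦ' : ContDiff ℝ ((2 * m : ℕ) : ℕ∞) Φ := hΦ.of_le (by exact_mod_cast (by omega))
    have ih' := fun n {lam} => @ih hΦ' n lam
    rcases lt_or_gt_of_ne hl with hneg | hpos
    · have hev : biradial d φ m n =ᶠ[nhds lam] splineSum d Φ m (-n - d) := by
        filter_upwards [Iio_mem_nhds hneg] with x hx
        rw [ih' n (ne_of_lt hx), if_neg (not_lt.2 (le_of_lt hx))]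
      rw [biradial, hev.deriv_eq, (hasDerivAt_splineSum d hΦ _ hl).deriv, ih' n hl, ih' (n + 1) hl,
        forwardCoeff, backwardCoeff]
      simp only [if_neg hneg.not_gt]
      rw [Nat.cast_succ,
        show -((n : ℝ) + 1) - d = -n - d - 1 by ring]
      push_cast
      ring
    · have hev : biradial d φ m n =ᶠ[nhds lam] splineSum d Φ m n := by
        filter_upwards [Ioi_mem_nhds hpos] with x hx
        rw [ih' n (ne_of_gt hx), if_pos (Set.mem_Ioi.1 hx)]
      rw [biradial, hev.deriv_eq, (hasDerivAt_splineSum d hΦ _ hl).deriv, ih' n hl, ih' (n - 1) hl,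
        forwardCoeff, backwardCoeff]
      simp only [if_pos hpos]
      cases n with
      | zero => simp
      | succ n =>
        rw [Nat.add_sub_cancel, Nat.cast_succ, add_sub_cancel_right]
        ring

/-- Continuity on a compact interval makes the real supremum genuine; an unbounded family would give
the default value 0. -/
theorem le_iSup_iteratedDeriv {Φ : ℝ → ℂ} {m l : ℕ} (hl : l ≤ m)
    (hΦ : ContDiff ℝ ((2 * m : ℕ) : ℕ∞) Φ) (c : ℂ) (x y : ℝ) {θ : ℝ}
    (hθ : θ ∈ Set.Icc (-(2 * (m : ℝ))) (2 * (m : ℝ))) :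
    ‖c * iteratedDeriv (m + l) Φ (x * (y + θ))‖
      ≤ ⨆ θ : Set.Icc (-(2 * (m : ℝ))) (2 * (m : ℝ)),
        ‖c * iteratedDeriv (m + l) Φ (x * (y + (θ : ℝ)))‖ := by
  have hc := continuous_iteratedDeriv_of_le hΦ (j := m + l) (by omega)
  have hcont : Continuous fun θ : Set.Icc (-(2 * (m : ℝ))) (2 * (m : ℝ)) =>
      ‖c * iteratedDeriv (m + l) Φ (x * (y + (θ : ℝ)))‖ := by fun_prop
  exact le_ciSup (isCompact_range hcont).bddAbove ⟨θ, hθ⟩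

theorem norm_splineSum_le (d m : ℕ) :
    ∃ C : ℝ, ∀ Φ : ℝ → ℂ, ContDiff ℝ ((2 * m : ℕ) : ℕ∞) Φ → ∀ (n : ℕ) (lam : ℝ), lam ≠ 0 →
      ‖splineSum d Φ m (if 0 < lam then (n : ℝ) else -n - d) lam‖
        ≤ C * ∑ l ∈ Finset.range (m + 1),
          ⨆ θ : Set.Icc (-(2 * (m : ℝ))) (2 * (m : ℝ)),
            ‖(((n : ℝ) * lam : ℝ) : ℂ) ^ l *
              iteratedDeriv (m + l) Φ (|lam| * ((d : ℝ) + 2 * (n : ℝ) + (θ : ℝ)))‖ := by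
  choose C hC0 hC using norm_splineFunctional_le d m
  choose D hD0 hD using norm_splineFunctional_deriv_le d m
  refine ⟨∑ l ∈ Finset.range (m + 1), (1 + d + l : ℝ) ^ l * (C l + D l), fun Φ hΦ n lam hlam => ?_⟩
  set S : ℕ → ℝ := fun l => ⨆ θ : Set.Icc (-(2 * (m : ℝ))) (2 * (m : ℝ)),
    ‖(((n : ℝ) * lam : ℝ) : ℂ) ^ l *
      iteratedDeriv (m + l) Φ (|lam| * ((d : ℝ) + 2 * (n : ℝ) + (θ : ℝ)))‖
  set a : ℝ := if 0 < lam then (n : ℝ) else -n - d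
  have hS0 : ∀ l, 0 ≤ S l := fun l => Real.iSup_nonneg fun _ => norm_nonneg _
  have hSle : ∀ l ∈ Finset.range (m + 1), S l ≤ ∑ l ∈ Finset.range (m + 1), S l := fun l hl =>
    Finset.single_le_sum (fun i _ => hS0 i) hl
  have ha : |a| ≤ n + d := by
    simp only [a]
    split_ifs
    · rw [abs_of_nonneg (by positivity)]
      linarith [(Nat.cast_nonneg d : (0 : ℝ) ≤ d)]
    · rw [show -(n : ℝ) - d = -(n + d) by ring, abs_neg, abs_of_nonneg (by positivity)]
  -- Take `θ = -τ` for positive and `θ = τ` for negative frequencies, which is why the window is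
  -- symmetric.
  have harg : ∀ τ ∈ Set.Icc (0 : ℝ) (2 * m), ∃ θ ∈ Set.Icc (-(2 * (m : ℝ))) (2 * (m : ℝ)),
      lam * (d + 2 * a - τ) = |lam| * ((d : ℝ) + 2 * (n : ℝ) + θ) := by
    intro τ hτ
    simp only [a]
    split_ifs with hpos
    · refine ⟨-τ, ⟨by linarith [hτ.2], by linarith [hτ.1, hτ.2]⟩, ?_⟩
      rw [abs_of_pos hpos]
      ring
    · refine ⟨τ, ⟨by linarith [hτ.1, hτ.2], hτ.2⟩, ?_⟩
      rw [abs_of_nonpos (not_lt.1 hpos)]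
      ring
  have hsup : ∀ l ≤ m, ∀ τ ∈ Set.Icc (0 : ℝ) (2 * m),
      ‖(((n : ℝ) * lam : ℝ) : ℂ) ^ l * iteratedDeriv (m + l) Φ (lam * (d + 2 * a - τ))‖ ≤ S l := by
    intro l hl τ hτ
    obtain ⟨θ, hθ, he⟩ := harg τ hτ
    rw [he]
    exact le_iSup_iteratedDeriv hl hΦ _ _ _ hθ
  rw [splineSum, Finset.sum_mul]
  refine (norm_sum_le _ _).trans (Finset.sum_le_sum fun l hl => ?_)
  have hlm : l ≤ m := Nat.lt_succ_iff.1 (Finset.mem_range.1 hl)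
  rw [norm_mul, Complex.norm_real, Real.norm_eq_abs, abs_mul, abs_pow]
  -- For `n = 0` and `λ < 0`, `a = -d` leaves terms with `l > 0` on the left that have no
  -- counterpart on the right.
  rcases Nat.eq_zero_or_pos n with hn | hn
  · have hff : |fallingFactorial a l| ≤ (1 + d + l : ℝ) ^ l := by
      refine abs_fallingFactorial_le l ?_
      rw [hn, Nat.cast_zero] at ha
      linarith
    -- These are the successive `τ`-derivatives of `Φ^(m)(λ(d + 2a - τ))`, so `λ^l Φ^(m+l)`
    -- integrates back to the term `l = 0`.
    set H : ℕ → ℝ → ℂ := fun i τ => (-lam : ℂ) ^ i * iteratedDeriv (m + i) Φ (lam * (d + 2 * a - τ))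
    have hH : ‖splineFunctional d m l (H l)‖ ≤ D l * S 0 := by
      refine hD l l le_rfl H (S 0) (fun i hi τ => ?_) (fun i hi => ?_) fun τ hτ => ?_
      · have hlin : HasDerivAt (fun τ : ℝ => lam * (d + 2 * a - τ)) (-lam) τ := by
          simpa using ((hasDerivAt_id τ).const_sub (d + 2 * a)).const_mul lam
        have h1 := ((hasDerivAt_iteratedDeriv hΦ (j := m + i) (by omega)
          (lam * (d + 2 * a - τ))).scomp τ hlin).const_mul ((-lam : ℂ) ^ i)
        rw [Complex.real_smul, Complex.ofReal_neg] at h1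
        refine h1.congr_deriv ?_
        simp only [H, pow_succ, ← add_assoc]
        ring
      · have := continuous_iteratedDeriv_of_le hΦ (j := m + i) (by omega)
        simp only [H]
        fun_prop
      · simpa [H] using hsup 0 (Nat.zero_le m) τ hτ
    have hH' : |lam| ^ l * ‖splineFunctional d m l fun τ =>
        iteratedDeriv (m + l) Φ (lam * (d + 2 * a - τ))‖ ≤ D l * S 0 := by
      simp only [H] at hH
      rwa [splineFunctional_const_mul, norm_mul, norm_pow, norm_neg, Complex.norm_real,
        Real.norm_eq_abs] at hH
    rw [mul_assoc, mul_assoc]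
    refine mul_le_mul hff (hH'.trans ?_) (by positivity) (by positivity)
    exact mul_le_mul (by linarith [hC0 l]) (hSle 0 (by simp)) (hS0 0) (add_nonneg (hC0 l) (hD0 l))
  · have hn1 : (1 : ℝ) ≤ n := by exact_mod_cast hn
    -- For `n ≥ 1`, `n + d + l ≤ (1 + d + l) n`.
    have hff : |fallingFactorial a l| ≤ (1 + d + l : ℝ) ^ l * (n : ℝ) ^ l := by
      rw [← mul_pow]
      refine abs_fallingFactorial_le l ?_
      have h1 : (0 : ℝ) ≤ d * (n - 1) := mul_nonneg (by positivity) (by linarith)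
      have h2 : (0 : ℝ) ≤ l * (n - 1) := mul_nonneg (by positivity) (by linarith)
      linarith
    have hT : ((n : ℝ) ^ l * |lam| ^ l) * ‖splineFunctional d m l fun τ =>
        iteratedDeriv (m + l) Φ (lam * (d + 2 * a - τ))‖ ≤ C l * S l := by
      have h1 := hC l _ _ (hsup l hlm)
      rwa [splineFunctional_const_mul, norm_mul, norm_pow, Complex.norm_real, Real.norm_eq_abs,
        abs_mul, Nat.abs_cast, mul_pow] at h1
    calc _ ≤ ((1 + d + l : ℝ) ^ l * (n : ℝ) ^ l) * |lam| ^ l * ‖splineFunctional d m l fun τ =>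
          iteratedDeriv (m + l) Φ (lam * (d + 2 * a - τ))‖ := by gcongr
      _ = (1 + d + l : ℝ) ^ l * (((n : ℝ) ^ l * |lam| ^ l) * ‖splineFunctional d m l fun τ =>
          iteratedDeriv (m + l) Φ (lam * (d + 2 * a - τ))‖) := by ring
      _ ≤ (1 + d + l : ℝ) ^ l * (C l * S l) := by gcongr
      _ ≤ (1 + d + l : ℝ) ^ l * ((C l + D l) * ∑ l ∈ Finset.range (m + 1), S l) := by
          gcongr
          · exact hS0 l
          · exact add_nonneg (hC0 l) (hD0 l)
          · linarith [hD0 l]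
          · exact hSle l hl
      _ = _ := by ring

end Heisenberg

end

theorem lemma3p2 (d : ℕ) (hd : 1 ≤ d) (m : ℕ) :
    ∃ C : ℝ, ∀ (φ : ℝ → ℂ) (f : Heisenberg.Pt d → ℂ),
      ContDiffOn ℝ ((2 * m : ℕ) : ℕ∞) φ (Set.Ici 0) →
      Heisenberg.IsL2Kernel φ f →
      ∃ Ω : ℕ → ℝ → ℂ,
        Heisenberg.IsBiradialTransform (fun v => Heisenberg.posPoly v ^ m * f v) Ω ∧
        ∀ Φ : ℝ → ℂ, ContDiff ℝ ((2 * m : ℕ) : ℕ∞) Φ → Set.EqOn Φ φ (Set.Ici 0) →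
          ∀ (n : ℕ) (lam : ℝ), lam ≠ 0 →
            ‖Ω n lam‖ ≤ C * ∑ l ∈ Finset.range (m + 1),
              ⨆ θ : Set.Icc (-(2 * (m : ℝ))) (2 * (m : ℝ)),
                ‖(((n : ℝ) * lam : ℝ) : ℂ) ^ l *
                  iteratedDeriv (m + l) Φ (|lam| * ((d : ℝ) + 2 * (n : ℝ) + (θ : ℝ)))‖ := by
  obtain ⟨C, hC⟩ := Heisenberg.norm_splineSum_le d m
  -- The transform is built from `φ` alone; the extension enters only the estimate, where the
  -- arguments can be negative.
  refine ⟨C, fun φ f hφ hf => ⟨Heisenberg.biradial d φ m, ?_, fun Φ hΦ h n lam hl => ?_⟩⟩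
  · exact hf.isBiradialTransform hd m
      ((hφ.mono Set.Ioi_subset_Ici_self).of_le (by exact_mod_cast (by omega)))
  · rw [Heisenberg.biradial_eq_splineSum m hΦ h n hl]
    exact hC Φ hΦ n lam hl
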